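/- Let $p\ge 3$ be a prime and let $\mathfrak G$ be a $p$-adic Vilenkin group: an abelian topological group whose topology is generated by a decreasing chain $(\mathfrak G_n)_{n\in\mathbb Z}$ of compact open subgroups with $\bigcup_n\mathfrak G_n=\mathfrak G$, $\bigcap_n\mathfrak G_n=\{0\}$ and $|\mathfrak G_n/\mathfrak G_{n+1}|=p$, together with elements $g_n\in\mathfrak G_n\setminus\mathfrak G_{n+1}$ such that $pg_n=0$. Every $x\in\mathfrak G$ is uniquely $x=\sum_{n}a_ng_n$ with $a_n\in\{0,\dots,p-1\}$ and $a_n=0$ for all sufficiently negative $n$. Notation. The dilation is $\mathcal A\left(\sum a_ng_n\right)=\sum a_ng_{n-1}$. Let $H_0$ be the set of all $a_{-1}g_{-1}+\dots+a_{-s}g_{-s}$, $s\in\mathbb N$, $a_j\in\{0,\dots,p-1\}$, and $H_0^{(s)}$ the set of those with the given $s$. Let $\mu$ be the Haar measure with $\mu(\mathfrak G_0)=1$, $X$ the group of continuous unitary characters, $(\chi,x)$ the value of $\chi\in X$ at $x$, $(\chi\mathcal A^k,x)=(\chi,\mathcal A^kx)$, $\mathfrak G_n^\perp=\{\chi\in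 X:(\chi,x)=1\ \forall x\in\mathfrak G_n\}$, and $\hat f(\chi)=\int_{\mathfrak G} f(x)\overline{(\chi,x)}\,d\mu(x)$. Let $\mathfrak D_M(\mathfrak G_{-N})$ be the set of $f\in L_2(\mathfrak G)$ with $\operatorname{supp}f\subset\mathfrak G_{-N}$ that are constant on the cosets of $\mathfrak G_M$. A function $\varphi$ is $1$-elementary refinable if there are coefficients $\beta_h\in\mathbb C$ $(h\in H_0^{(2)})$ with $\varphi(x)=\sum_{h\in H_0^{(2)}}\beta_h\varphi(\mathcal Ax-h)$ such that the mask $m_0(\chi)=\frac1p\sum_{h\in H_0^{(2)}}\beta_h\overline{(\chi\mathcal A^{-1},h)}$ is constant on the cosets of $\mathfrak G_{-1}^\perp$, $|m_0|$ takes exactly the two values $0$ and $1$, and $\hat\varphi(\chi)=\prod_{j=0}^\infty m_0(\chi\mathcal A^{-j})$ for all $\chi\in X$. The function $\varphi$ generates an orthogonal MRA if $(\varphi(x-h))_{h\in H_0}$ is an orthonormal system in $L_2(\mathfrak G)$ and the closed linear spans $V_j$ of $(\varphi(\mathcal A^jx-h))_{h\in H_0}$, $j\in\mathbb Z$, form a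 multiresolution analysis, that is: $V_j\subset V_{j+1}$; $\overline{\bigcup_jV_j}=L_2(\mathfrak G)$ and $\bigcap_jV_j=\{0\}$; $f\in V_j\Leftrightarrow f(\mathcal A\,\cdot)\in V_{j+1}$; $f\in V_0\Rightarrow f(\cdot-h)\in V_0$ for all $h\in H_0$; and $V_0$ has an orthonormal basis of the form $(\psi(x-h))_{h\in H_0}$ with $\psi\in L_2(\mathfrak G)$. Theorem. For every integer $l$ with $1\le l\le p-2$ there exists a $1$-elementary refinable function $\varphi\in\mathfrak D_l(\mathfrak G_{-1})$ that generates an orthogonal MRA of $L_2(\mathfrak G)$ and whose Fourier transform $\hat\varphi$ does not vanish identically on $\mathfrak G_l^\perp\setminus\mathfrak G_{l-1}^\perp$. -/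

import Mathlib

open MeasureTheory Filter Topology Set

/-- A `p`-adic Vilenkin group: an abelian topological group whose topology is generated by a
decreasing chain `(G n)` of compact open subgroups with union `G`, intersection `{0}` and all
quotients `G n / G (n+1)` of order `p`, together with a basic system
`g n ∈ G n \ G (n+1)` such that `p • g n = 0`. -/
structure VilenkinGroup (p : ℕ) (G : Type*) [AddCommGroup G] [TopologicalSpace G] where
  /-- the chain of subgroups -/
  sub : ℤ → AddSubgroup G
  isOpen_sub : ∀ n, IsOpen (sub n : Set G)
  isCompact_sub : ∀ n, IsCompact (sub n : Set G)
  sub_succ_le : ∀ n, sub (n + 1) ≤ sub n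
  iUnion_sub : ⋃ n, (sub n : Set G) = univ
  iInter_sub : ⋂ n, (sub n : Set G) = {0}
  exists_sub_subset : ∀ U ∈ 𝓝 (0 : G), ∃ n, (sub n : Set G) ⊆ U
  relIndex_sub : ∀ n, (sub (n + 1)).relIndex (sub n) = p
  /-- the basic system -/
  g : ℤ → G
  g_mem : ∀ n, g n ∈ sub n
  g_notMem : ∀ n, g n ∉ sub (n + 1)
  smul_g : ∀ n, p • g n = 0

namespace VilenkinGroup

section Dilation

variable {p : ℕ} {G : Type*} [AddCommGroup G] [TopologicalSpace G] (V : VilenkinGroup p G)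

/-- `x = ∑ a_n g_n` with digits `a_n ∈ {0, …, p-1}`, only finitely many of which are non-zero at
negative indices. -/
def IsExpansion (a : ℤ → ZMod p) (x : G) : Prop :=
  (∃ m, ∀ n < m, a n = 0) ∧ HasSum (fun n => (a n).val • V.g n) x

theorem sub_antitone {m n : ℤ} (h : m ≤ n) : V.sub n ≤ V.sub m := by
  induction n, h using Int.leInduction with
  | base => exact le_rfl
  | succ n _ ih => exact (V.sub_succ_le n).trans ih

theorem sum_sub_sum_mem {a : ℤ → ZMod p} {m : ℤ} (h0 : ∀ n < m, a n = 0) (k : ℤ)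
    {F : Finset ℤ} (hF : Finset.Ico m k ⊆ F) :
    ∑ n ∈ F, (a n).val • V.g n - ∑ n ∈ Finset.Ico m k, (a n).val • V.g n ∈ V.sub k := by
  rw [← Finset.sum_sdiff hF, add_sub_cancel_right]
  refine sum_mem fun n hn => ?_
  rw [Finset.mem_sdiff, Finset.mem_Ico, not_and_or] at hn
  rcases hn.2 with h | h
  · rw [h0 n (not_le.1 h)]
    simp
  · exact nsmul_mem (V.sub_antitone (not_lt.1 h) (V.g_mem n)) _

theorem isExpansion_iff [IsTopologicalAddGroup G] (a : ℤ → ZMod p) (x : G) :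
    V.IsExpansion a x ↔ ∃ m, (∀ n < m, a n = 0) ∧
      ∀ k, m ≤ k → x - ∑ n ∈ Finset.Ico m k, (a n).val • V.g n ∈ V.sub k := by
  constructor
  · rintro ⟨⟨m, h0⟩, hs⟩
    refine ⟨m, h0, fun k _ => ?_⟩
    have hc : IsClosed (V.sub k : Set G) := (V.sub k).isClosed_of_isOpen (V.isOpen_sub k)
    exact hc.mem_of_tendsto (hs.sub_const _)
      (eventually_atTop.2 ⟨Finset.Ico m k, fun F hF => V.sum_sub_sum_mem h0 k hF⟩)
  · rintro ⟨m, h0, hx⟩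
    refine ⟨⟨m, h0⟩, fun U hU => ?_⟩
    have hW : (fun z => x - z) ⁻¹' U ∈ 𝓝 (0 : G) :=
      (by fun_prop : Continuous fun z : G => x - z).continuousAt (by simpa using hU)
    obtain ⟨k, hk⟩ := V.exists_sub_subset _ hW
    refine mem_map.2 (mem_atTop_sets.2 ⟨Finset.Ico m (max m k), fun F hF => ?_⟩)
    have h1 := sub_mem (hx _ (le_max_left m k)) (V.sum_sub_sum_mem h0 _ hF)
    rw [sub_sub_sub_cancel_right] at h1
    simpa using hk (V.sub_antitone (le_max_right m k) h1)

theorem t2Space [IsTopologicalAddGroup G] (V : VilenkinGroup p G) : T2Space G := by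
  refine IsTopologicalAddGroup.t2Space_of_zero_sep fun x hx => ?_
  have : x ∉ ⋂ n, (V.sub n : Set G) := by rwa [V.iInter_sub]
  obtain ⟨n, hn⟩ := not_forall.1 fun h => this (mem_iInter.2 h)
  exact ⟨V.sub n, (V.isOpen_sub n).mem_nhds (V.sub n).zero_mem, hn⟩

variable [Fact p.Prime]

theorem val_add_smul (a b : ZMod p) (n : ℤ) :
    (a + b).val • V.g n = a.val • V.g n + b.val • V.g n := by
  rw [ZMod.val_add, ← nsmul_eq_mod_nsmul _ (V.smul_g n), add_nsmul]

theorem val_sub_smul (a b : ZMod p) (n : ℤ) :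
    (a - b).val • V.g n = a.val • V.g n - b.val • V.g n := by
  rw [eq_sub_iff_add_eq, ← V.val_add_smul, sub_add_cancel]

theorem eq_zero_of_smul_mem {n : ℤ} {c : ZMod p} (h : c.val • V.g n ∈ V.sub (n + 1)) :
    c = 0 := by
  by_contra hc
  have h1 : c⁻¹.val • c.val • V.g n = V.g n := by
    rw [smul_smul, nsmul_eq_mod_nsmul _ (V.smul_g n), ← ZMod.val_mul, inv_mul_cancel₀ hc,
      ZMod.val_one, one_smul]
  exact V.g_notMem n (h1 ▸ nsmul_mem h _)

theorem exists_digit {n : ℤ} {x : G} (hx : x ∈ V.sub n) :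
    ∃ c : ZMod p, x - c.val • V.g n ∈ V.sub (n + 1) := by
  have hcard : Nat.card (V.sub n ⧸ (V.sub (n + 1)).addSubgroupOf (V.sub n)) = p :=
    V.relIndex_sub n
  have hg : ((⟨V.g n, V.g_mem n⟩ : V.sub n) :
      V.sub n ⧸ (V.sub (n + 1)).addSubgroupOf (V.sub n)) ≠ 0 := by
    rw [Ne, QuotientAddGroup.eq_zero_iff, AddSubgroup.mem_addSubgroupOf]
    exact V.g_notMem n
  obtain ⟨k, hk⟩ := mem_zmultiples_of_prime_card hcard hg
    (g' := ((⟨x, hx⟩ : V.sub n) : V.sub n ⧸ (V.sub (n + 1)).addSubgroupOf (V.sub n)))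
  have h1 : -(k • V.g n) + x ∈ V.sub (n + 1) := by
    have := QuotientAddGroup.eq.1 hk
    simpa [AddSubgroup.mem_addSubgroupOf] using this
  refine ⟨(k : ZMod p), ?_⟩
  have h2 : ((k : ZMod p).val) • V.g n = k • V.g n := by
    rw [← natCast_zsmul, ZMod.val_intCast]
    conv_rhs => rw [← Int.emod_add_mul_ediv k p]
    rw [add_smul, mul_comm, mul_smul, natCast_zsmul, V.smul_g, smul_zero, add_zero]
  rw [h2]
  rwa [neg_add_eq_sub] at h1

theorem exists_isExpansion [IsTopologicalAddGroup G] (x : G) :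
    ∃ a, V.IsExpansion a x := by
  obtain ⟨m, hm⟩ := mem_iUnion.1 (V.iUnion_sub ▸ mem_univ x : x ∈ ⋃ n, (V.sub n : Set G))
  have hd : ∀ (n : ℤ) (y : G), ∃ c : ZMod p, y ∈ V.sub n → y - c.val • V.g n ∈ V.sub (n + 1) := by
    intro n y
    by_cases hy : y ∈ V.sub n
    · obtain ⟨c, hc⟩ := V.exists_digit hy
      exact ⟨c, fun _ => hc⟩
    · exact ⟨0, fun h => absurd h hy⟩
  choose c hc using hd
  let y : ℕ → G := fun i => Nat.rec x (fun i z => z - (c (m + i) z).val • V.g (m + i)) i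
  let a : ℤ → ZMod p := fun n => if n < m then 0 else c n (y (n - m).toNat)
  have key : ∀ i : ℕ, y i ∈ V.sub (m + i) ∧
      x - ∑ n ∈ Finset.Ico m (m + i), (a n).val • V.g n = y i := by
    intro i
    induction i with
    | zero => simpa [y] using hm
    | succ i ih =>
      have h1 : y (i + 1) = y i - (c (m + i) (y i)).val • V.g (m + i) := rfl
      have h2 : a (m + i) = c (m + i) (y i) := by simp [a]
      have h3 : Finset.Ico m (m + ((i + 1 : ℕ) : ℤ)) = insert (m + i : ℤ) (Finset.Ico m (m + i)) := by
        ext n; simp only [Finset.mem_Ico, Finset.mem_insert]; push_cast; omega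
      refine ⟨?_, ?_⟩
      · rw [h1]
        push_cast
        rw [← add_assoc]
        exact hc _ _ ih.1
      · rw [h3, Finset.sum_insert (by simp), h1, h2, ← sub_sub, sub_right_comm, ih.2]
  refine ⟨a, (V.isExpansion_iff a x).2 ⟨m, fun n hn => by simp [a, hn], fun k hk => ?_⟩⟩
  obtain ⟨i, rfl⟩ := Int.le.dest hk
  rw [(key i).2]
  exact (key i).1

theorem IsExpansion.unique [IsTopologicalAddGroup G] {V : VilenkinGroup p G} {a b : ℤ → ZMod p}
    {x : G} (ha : V.IsExpansion a x) (hb : V.IsExpansion b x) : a = b := by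
  obtain ⟨⟨m, ha0⟩, hsa⟩ := ha
  obtain ⟨⟨m', hb0⟩, hsb⟩ := hb
  have h0 : ∀ n < min m m', (a - b) n = 0 := fun n hn => by
    simp [ha0 n (hn.trans_le (min_le_left _ _)), hb0 n (hn.trans_le (min_le_right _ _))]
  have hab : HasSum (fun n => ((a - b) n).val • V.g n) 0 := by
    simpa [V.val_sub_smul] using hsa.sub hsb
  have hc : ∀ k, ∑ n ∈ Finset.Ico (min m m') k, ((a - b) n).val • V.g n ∈ V.sub k := fun k => by
    have hcl : IsClosed (V.sub k : Set G) := (V.sub k).isClosed_of_isOpen (V.isOpen_sub k)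
    have := hcl.mem_of_tendsto (hab.sub_const _)
      (eventually_atTop.2 ⟨Finset.Ico (min m m') k, fun F hF => V.sum_sub_sum_mem h0 k hF⟩)
    simpa using this
  have hz : ∀ i : ℕ, ∀ n < min m m' + i, (a - b) n = 0 := by
    intro i
    induction i with
    | zero => simpa using h0
    | succ i ih =>
      intro n hn
      rcases lt_or_ge n (min m m' + i) with h | h
      · exact ih n h
      · obtain rfl : n = min m m' + i := by push_cast at hn; omega
        refine V.eq_zero_of_smul_mem (n := min m m' + i) ?_
        have h1 := hc (min m m' + i + 1)
        rwa [Finset.sum_eq_single (min m m' + (i : ℤ))] at h1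
        · intro j hj hne
          rw [Finset.mem_Ico] at hj
          rw [ih j (by omega)]
          simp
        · intro h2
          exact absurd (Finset.mem_Ico.2 ⟨by omega, by omega⟩) h2
  funext n
  refine sub_eq_zero.1 (hz (n - min m m' + 1).toNat n ?_)
  omega

theorem exists_of_digits [IsTopologicalAddGroup G] {a : ℤ → ZMod p} {m : ℤ}
    (h0 : ∀ n < m, a n = 0) : ∃ x, V.IsExpansion a x := by
  let s : ℕ → G := fun i => ∑ n ∈ Finset.Ico m (m + i), (a n).val • V.g n
  have hs : ∀ i, s i ∈ (V.sub m : Set G) := fun i => sum_mem fun n hn =>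
    nsmul_mem (V.sub_antitone (Finset.mem_Ico.1 hn).1 (V.g_mem n)) _
  obtain ⟨x, -, hx⟩ := (V.isCompact_sub m).exists_mapClusterPt (f := atTop) (u := s)
    (tendsto_principal.2 (Eventually.of_forall hs))
  refine ⟨x, (V.isExpansion_iff a x).2 ⟨m, h0, fun k hk => ?_⟩⟩
  obtain ⟨i, rfl⟩ := Int.le.dest hk
  have hW : (fun z => z - x) ⁻¹' (V.sub (m + i) : Set G) ∈ 𝓝 x :=
    (by fun_prop : Continuous fun z : G => z - x).continuousAt
      (by simpa using (V.isOpen_sub (m + i)).mem_nhds (V.sub (m + i)).zero_mem)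
  obtain ⟨j, hj, hij⟩ := ((mapClusterPt_iff_frequently.1 hx _ hW).and_eventually
    (eventually_ge_atTop i)).exists
  have h1 := V.sum_sub_sum_mem h0 (m + i) (F := Finset.Ico m (m + j))
    (Finset.Ico_subset_Ico_right (by omega))
  have h2 : s j - x ∈ V.sub (m + i) := hj
  have h3 := sub_mem h1 h2
  have h4 : x - ∑ n ∈ Finset.Ico m (m + (i : ℤ)), (a n).val • V.g n =
      s j - ∑ n ∈ Finset.Ico m (m + (i : ℤ)), (a n).val • V.g n - (s j - x) := by abel
  rw [h4]
  exact h3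

variable [IsTopologicalAddGroup G]

/-- The digits `a_n` of `x = ∑ a_n g_n`. -/
noncomputable def digit (x : G) : ℤ → ZMod p := (V.exists_isExpansion x).choose

theorem isExpansion_digit (x : G) : V.IsExpansion (V.digit x) x :=
  (V.exists_isExpansion x).choose_spec

theorem digit_eq {a : ℤ → ZMod p} {x : G} (h : V.IsExpansion a x) : V.digit x = a :=
  (V.isExpansion_digit x).unique h

theorem IsExpansion.eq {V : VilenkinGroup p G} {a : ℤ → ZMod p} {x y : G}
    (hx : V.IsExpansion a x) (hy : V.IsExpansion a y) : x = y :=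
  have := V.t2Space
  hx.2.unique hy.2

theorem IsExpansion.add {V : VilenkinGroup p G} {a b : ℤ → ZMod p} {x y : G}
    (hx : V.IsExpansion a x) (hy : V.IsExpansion b y) : V.IsExpansion (a + b) (x + y) := by
  obtain ⟨⟨m, ha0⟩, hsa⟩ := hx
  obtain ⟨⟨m', hb0⟩, hsb⟩ := hy
  refine ⟨⟨min m m', fun n hn => ?_⟩, ?_⟩
  · simp [ha0 n (hn.trans_le (min_le_left _ _)), hb0 n (hn.trans_le (min_le_right _ _))]
  · simpa [V.val_add_smul] using hsa.add hsb

/-- The map `∑ a_n g_n ↦ ∑ a_n g_{n-k}`, which is the `k`-th power of the dilation `𝒜`. -/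
noncomputable def dilFun (k : ℤ) (x : G) : G := ∑' n, (V.digit x n).val • V.g (n - k)

theorem isExpansion_dilFun (k : ℤ) (x : G) :
    V.IsExpansion (fun n => V.digit x (n + k)) (V.dilFun k x) := by
  obtain ⟨m, hm⟩ := (V.isExpansion_digit x).1
  have h0 : ∀ n < m - k, V.digit x (n + k) = 0 := fun n hn => hm _ (by omega)
  obtain ⟨y, hy⟩ := V.exists_of_digits h0
  have h1 : HasSum (fun n => (V.digit x n).val • V.g (n - k)) y := by
    rw [← (Equiv.addRight k).hasSum_iff]
    simpa [Function.comp_def] using hy.2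
  have := V.t2Space
  rw [dilFun, h1.tsum_eq]
  exact hy

theorem digit_dilFun (k : ℤ) (x : G) (n : ℤ) : V.digit (V.dilFun k x) n = V.digit x (n + k) := by
  rw [V.digit_eq (V.isExpansion_dilFun k x)]

theorem ext_digit {x y : G} (h : ∀ n, V.digit x n = V.digit y n) : x = y :=
  (V.isExpansion_digit x).eq ((funext h : V.digit x = V.digit y) ▸ V.isExpansion_digit y)

theorem digit_add (x y : G) (n : ℤ) : V.digit (x + y) n = V.digit x n + V.digit y n := by
  rw [V.digit_eq ((V.isExpansion_digit x).add (V.isExpansion_digit y))]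
  rfl

theorem mem_sub_iff (x : G) (k : ℤ) : x ∈ V.sub k ↔ ∀ n < k, V.digit x n = 0 := by
  constructor
  · intro hx
    obtain ⟨m, h0, hm⟩ := (V.isExpansion_iff _ x).1 (V.isExpansion_digit x)
    have hz : ∀ i : ℕ, ∀ n < m + i, n < k → V.digit x n = 0 := by
      intro i
      induction i with
      | zero => exact fun n hn _ => h0 n (by simpa using hn)
      | succ i ih =>
        intro n hn hnk
        rcases lt_or_ge n (m + i) with h | h
        · exact ih n h hnk
        · obtain rfl : n = m + i := by push_cast at hn; omega
          have h1 := hm (m + i + 1) (by omega)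
          rw [Finset.sum_eq_single (m + (i : ℤ))] at h1
          · refine V.eq_zero_of_smul_mem (n := m + i) ?_
            have h2 := sub_mem (V.sub_antitone (by omega) hx) h1
            simpa using h2
          · intro j hj hne
            rw [Finset.mem_Ico] at hj
            rw [ih j (by omega) (by omega)]
            simp
          · intro h2
            exact absurd (Finset.mem_Ico.2 ⟨by omega, by omega⟩) h2
    exact fun n hn => hz (n - m + 1).toNat n (by omega) hn
  · intro h0
    have hcl : IsClosed (V.sub k : Set G) := (V.sub k).isClosed_of_isOpen (V.isOpen_sub k)
    refine hcl.mem_of_tendsto (V.isExpansion_digit x).2 (Eventually.of_forall fun F => ?_)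
    refine sum_mem fun n _ => ?_
    rcases lt_or_ge n k with h | h
    · rw [h0 n h]
      simp
    · exact nsmul_mem (V.sub_antitone h (V.g_mem n)) _

theorem continuous_dilFun (k : ℤ) : Continuous (V.dilFun k) := by
  let f : G →+ G := AddMonoidHom.mk' (V.dilFun k) fun x y => V.ext_digit fun n => by
    simp only [V.digit_add, V.digit_dilFun]
  refine continuous_of_continuousAt_zero f ?_
  intro U hU
  rw [map_zero] at hU
  obtain ⟨n, hn⟩ := V.exists_sub_subset U hU
  refine mem_map.2 (mem_of_superset
    ((V.isOpen_sub (n + k)).mem_nhds (V.sub (n + k)).zero_mem) fun x hx => hn ?_)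
  refine (V.mem_sub_iff _ _).2 fun j hj => ?_
  exact (V.digit_dilFun k x j).trans ((V.mem_sub_iff _ _).1 hx _ (by omega))

/-- `V.dil k = 𝒜^k`, where the dilation operator `𝒜 = V.dil 1` sends `∑ a_n g_n` to
`∑ a_n g_{n-1}`; it is an automorphism of the topological group. -/
noncomputable def dil (k : ℤ) : G ≃ₜ+ G where
  toFun := V.dilFun k
  invFun := V.dilFun (-k)
  left_inv x := V.ext_digit fun n => by simp [V.digit_dilFun]
  right_inv x := V.ext_digit fun n => by simp [V.digit_dilFun]
  map_add' x y := V.ext_digit fun n => by simp only [V.digit_add, V.digit_dilFun]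
  continuous_toFun := V.continuous_dilFun k
  continuous_invFun := V.continuous_dilFun (-k)

theorem dil_apply (k : ℤ) (x : G) : V.dil k x = ∑' n, (V.digit x n).val • V.g (n - k) := rfl

theorem dil_zero (x : G) : V.dil 0 x = x :=
  V.ext_digit fun n => (V.digit_dilFun 0 x n).trans (by rw [add_zero])

theorem dil_add (j k : ℤ) (x : G) : V.dil (j + k) x = V.dil j (V.dil k x) :=
  V.ext_digit fun n => by
    refine (V.digit_dilFun _ x n).trans (Eq.symm ((V.digit_dilFun _ _ n).trans
      ((V.digit_dilFun _ _ _).trans ?_)))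
    rw [add_assoc]

end Dilation

section Analysis

variable {p : ℕ} [Fact p.Prime] {G : Type*} [AddCommGroup G] [TopologicalSpace G]
  [IsTopologicalAddGroup G] (V : VilenkinGroup p G)

/-! #### Characters -/

/-- The value `(χ, x)` of a (continuous, unitary) character `χ` of `G` at `x ∈ G`. -/
noncomputable def pairing (χ : PontryaginDual (Multiplicative G)) (x : G) : ℂ :=
  (χ (Multiplicative.ofAdd x) : Circle)

/-- The annihilator of the subgroup `G n` in the character group. -/
def annihilator (n : ℤ) : Set (PontryaginDual (Multiplicative G)) :=
  {χ | ∀ x ∈ V.sub n, pairing χ x = 1}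

/-- The character `χ𝒜^k`, that is, `(χ𝒜^k, x) = (χ, 𝒜^k x)`. -/
noncomputable def charDil (χ : PontryaginDual (Multiplicative G)) (k : ℤ) :
    PontryaginDual (Multiplicative G) where
  toFun y := χ (Multiplicative.ofAdd (V.dil k y.toAdd))
  map_one' := by simp
  map_mul' y z := by simp
  continuous_toFun := (map_continuous χ).comp
    (continuous_ofAdd.comp ((V.dil k).continuous.comp continuous_toAdd))

theorem pairing_charDil (χ : PontryaginDual (Multiplicative G)) (k : ℤ) (x : G) :
    pairing (V.charDil χ k) x = pairing χ (V.dil k x) := rfl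

/-! #### The shift set `H₀` -/

/-- The point `a_{-1} g_{-1} + ⋯ + a_{-s} g_{-s}`, where `a_{-j-1}` is written `a j`. -/
noncomputable def shiftPoint {s : ℕ} (a : Fin s → ZMod p) : G :=
  ∑ j : Fin s, (a j).val • V.g (-1 - (j : ℤ))

/-- The set `H₀` of all finite sums `a_{-1} g_{-1} + ⋯ + a_{-s} g_{-s}`, `s ∈ ℕ`. -/
def H₀ : Set G := {h | ∃ (s : ℕ) (a : Fin s → ZMod p), h = V.shiftPoint a}

/-! #### Haar measure and Fourier transform -/

variable [MeasurableSpace G] [BorelSpace G]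

/-- The compact open subgroup `G 0`. -/
def unitBall : TopologicalSpace.PositiveCompacts G where
  carrier := V.sub 0
  isCompact' := V.isCompact_sub 0
  interior_nonempty' := by
    rw [(V.isOpen_sub 0).interior_eq]
    exact ⟨0, (V.sub 0).zero_mem⟩

/-- The Haar measure on `G`, normalized so that `G 0` has measure one. -/
noncomputable def μ : Measure G := Measure.addHaarMeasure V.unitBall

/-- The Fourier transform, given by the absolutely convergent integral
(so for functions in `L¹`, in particular for compactly supported functions in `L²`). -/
noncomputable def fourier (f : G → ℂ) (χ : PontryaginDual (Multiplicative G)) : ℂ :=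
  ∫ x, f x * (starRingEnd ℂ) (pairing χ x) ∂V.μ

/-- The class `𝔇_M(G_{-N})` of step functions in `L²` supported in `G_{-N}` and constant on the
cosets of `G_M`. -/
structure IsStep (M N : ℤ) (f : G → ℂ) : Prop where
  memLp : MemLp f 2 V.μ
  support_subset : tsupport f ⊆ V.sub (-N)
  const_on_cosets : ∀ x, ∀ y ∈ V.sub M, f (x + y) = f x

/-! #### Multiresolution analyses -/

/-- The elements of `L²` represented by the functions `x ↦ φ(𝒜ʲx - h)`, `h ∈ H₀`. -/
def system (φ : G → ℂ) (j : ℤ) : Set (Lp ℂ 2 V.μ) :=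
  {F | ∃ h ∈ V.H₀, F =ᵐ[V.μ] fun x => φ (V.dil j x - h)}

/-- The system `(φ(x - h))`, `h ∈ H₀`, consists of functions in `L²` and is orthonormal. -/
def IsOrthonormalSystem (φ : G → ℂ) : Prop :=
  ∃ e : V.H₀ → Lp ℂ 2 V.μ,
    (∀ h : V.H₀, e h =ᵐ[V.μ] fun x => φ (x - h)) ∧ Orthonormal ℂ e

/-- A multiresolution analysis of `L²(G)`. -/
structure IsMRA (W : ℤ → Submodule ℂ (Lp ℂ 2 V.μ)) : Prop where
  isClosed : ∀ n, IsClosed (W n : Set (Lp ℂ 2 V.μ))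
  mono : ∀ n, W n ≤ W (n + 1)
  dense_iUnion : closure (⋃ n, (W n : Set (Lp ℂ 2 V.μ))) = univ
  iInter_eq : ⋂ n, (W n : Set (Lp ℂ 2 V.μ)) = {0}
  dil_mem_iff : ∀ (n : ℤ) (f f' : Lp ℂ 2 V.μ), (f' =ᵐ[V.μ] fun x => f (V.dil 1 x)) →
    (f ∈ W n ↔ f' ∈ W (n + 1))
  shift_mem : ∀ f ∈ W 0, ∀ h ∈ V.H₀, ∀ f' : Lp ℂ 2 V.μ, (f' =ᵐ[V.μ] fun x => f (x - h)) →
    f' ∈ W 0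
  exists_scaling : ∃ φ : G → ℂ, V.IsOrthonormalSystem φ ∧
    (Submodule.span ℂ (V.system φ 0)).topologicalClosure = W 0

/-- `φ` generates an orthogonal MRA: its `H₀`-shifts form an orthonormal system and the closed
linear spans of the systems `(φ(𝒜ʲx - h))`, `h ∈ H₀`, form an MRA. -/
def GeneratesMRA (φ : G → ℂ) : Prop :=
  V.IsOrthonormalSystem φ ∧
    V.IsMRA fun j => (Submodule.span ℂ (V.system φ j)).topologicalClosure

/-! #### Masks and elementary refinable functions -/

/-- `φ(x) = ∑ β_h φ(𝒜x - h)`, the sum being over `h = a_{-1} g_{-1} + ⋯ + a_{-s} g_{-s}`. -/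
def SatisfiesRefinement (s : ℕ) (β : (Fin s → ZMod p) → ℂ) (φ : G → ℂ) : Prop :=
  ∀ x, φ x = ∑ a, β a * φ (V.dil 1 x - V.shiftPoint a)

/-- The mask `m₀(χ) = p⁻¹ ∑ β_h conj (χ𝒜⁻¹, h)` of the refinement equation with
coefficients `β`. -/
noncomputable def mask (s : ℕ) (β : (Fin s → ZMod p) → ℂ)
    (χ : PontryaginDual (Multiplicative G)) : ℂ :=
  (1 / (p : ℂ)) * ∑ a, β a * (starRingEnd ℂ) (pairing (V.charDil χ (-1)) (V.shiftPoint a))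

/-- A function on the character group is `N`-elementary if it is constant on the cosets of the
annihilator of `G_{-N}` and its modulus takes exactly the two values `0` and `1`. -/
structure IsElementary (N : ℕ) (m₀ : PontryaginDual (Multiplicative G) → ℂ) : Prop where
  const_on_cosets : ∀ χ, ∀ ξ ∈ V.annihilator (-N), m₀ (χ * ξ) = m₀ χ
  range_norm : range (fun χ => ‖m₀ χ‖) = {0, 1}

/-- `φ` is an `N`-elementary refinable function: it is integrable and solves a refinement equation
with coefficients indexed by `h = a_{-1} g_{-1} + ⋯ + a_{-N-1} g_{-N-1}`, whose mask `m₀` is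
`N`-elementary and satisfies `φ̂(χ) = ∏_{j ≥ 0} m₀(χ𝒜⁻ʲ)`. -/
def IsElementaryRefinable (N : ℕ) (φ : G → ℂ) : Prop :=
  Integrable φ V.μ ∧ ∃ β : (Fin (N + 1) → ZMod p) → ℂ,
    V.SatisfiesRefinement (N + 1) β φ ∧
    V.IsElementary N (V.mask (N + 1) β) ∧
    ∀ χ, Tendsto (fun n : ℕ => ∏ j ∈ Finset.range n, V.mask (N + 1) β (V.charDil χ (-(j : ℤ))))
      atTop (𝓝 (V.fourier φ χ))

end Analysis
end VilenkinGroup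

set_option linter.unusedSectionVars false

/-! A character χ is encoded by its frequencies x_n ∈ ZMod p, where (χ, g_n) = exp(2πi x_n/p). The
annihilator of G_k is given by x_n = 0 for n ≥ k, and χ𝒜^k has frequencies x_{n-k}
(`mem_annihilator_iff`, `freq_charDil`).

Let f be a self-map of ZMod p with f^L = 0, that is, a tree rooted at 0 of height at most L. Take as
mask the indicator of the relation x_0 = f(x_{-1}) (`mask_treeCoeff`). The infinite product is then
the indicator of the characters with x_j = f(x_{j-1}) for all j ≥ 0. Modulo the annihilator of
G_{-1} there are exactly p of these, one for each a = x_{-1}, with frequencies a, f a, f² a, … that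
vanish from index L-1 on. Hence φ is p⁻¹ times the sum of these p characters, restricted to G_{-1},
and it is constant on the cosets of G_{L-1} (`fourier_treeScaling`, `treeScaling_add_mem`).

Because each value of x_{-1} occurs exactly once, orthogonality of the characters of ZMod p yields
both the orthonormality of the shifts (`integral_treeScaling_sub_mul_conj`) and the identity ∑_c φ(x
- c g_{-1}) = 1_{G_{-1}}(x) (`sum_treeScaling_sub`). By the latter the spaces V_j contain all
indicators of cosets of the G_n, so their union is dense. An element of every V_j is invariant under
all translations, hence zero because G is not compact (`eq_zero_of_forall_transLp_eq`).

Finally f is chosen as the chain l+1 → l → ⋯ → 1 → 0, with all other elements sent to 0. It fits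
into ZMod p because l + 1 < p, and the orbit of l+1 has frequency 1 at index l-1. -/

namespace VilenkinGroup
-- Digit calculus and the shift set
section Digits

variable {p : ℕ} [Fact p.Prime] {G : Type*} [AddCommGroup G] [TopologicalSpace G]
  [IsTopologicalAddGroup G] (V : VilenkinGroup p G)

/-- The `n`-th digit as an additive homomorphism. -/
noncomputable def digitHom (n : ℤ) : G →+ ZMod p :=
  AddMonoidHom.mk' (fun x => V.digit x n) fun x y => V.digit_add x y n

theorem digit_zero (n : ℤ) : V.digit 0 n = 0 := map_zero (V.digitHom n)

theorem digit_neg (x : G) (n : ℤ) : V.digit (-x) n = -V.digit x n := map_neg (V.digitHom n) x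

theorem digit_sub (x y : G) (n : ℤ) : V.digit (x - y) n = V.digit x n - V.digit y n :=
  map_sub (V.digitHom n) x y

theorem digit_nsmul (k : ℕ) (x : G) (n : ℤ) : V.digit (k • x) n = k • V.digit x n :=
  map_nsmul (V.digitHom n) k x

theorem digit_sum {ι : Type*} (s : Finset ι) (x : ι → G) (n : ℤ) :
    V.digit (∑ i ∈ s, x i) n = ∑ i ∈ s, V.digit (x i) n :=
  map_sum (V.digitHom n) x s

theorem digit_val_nsmul (c : ZMod p) (x : G) (n : ℤ) :
    V.digit (c.val • x) n = c * V.digit x n := by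
  rw [digit_nsmul, nsmul_eq_mul, ZMod.natCast_zmod_val]

theorem digit_dil (k : ℤ) (x : G) (n : ℤ) : V.digit (V.dil k x) n = V.digit x (n + k) :=
  V.digit_dilFun k x n

theorem digit_g (m n : ℤ) : V.digit (V.g m) n = if n = m then 1 else 0 := by
  have : V.IsExpansion (fun n => if n = m then 1 else 0) (V.g m) := by
    refine ⟨⟨m, fun n hn => if_neg hn.ne⟩, ?_⟩
    convert hasSum_single (f := fun n => (if n = m then (1 : ZMod p) else 0).val • V.g n) m ?_
      using 1
    · simp [ZMod.val_one]
    · intro n hn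
      simp [hn]
  rw [V.digit_eq this]

theorem digit_eq_zero_of_mem {x : G} {k n : ℤ} (hx : x ∈ V.sub k) (hn : n < k) :
    V.digit x n = 0 := (V.mem_sub_iff x k).1 hx n hn

theorem digit_shiftPoint {s : ℕ} (a : Fin s → ZMod p) (n : ℤ) :
    V.digit (V.shiftPoint a) n = ∑ j : Fin s, if n = -1 - (j : ℤ) then a j else 0 := by
  simp [shiftPoint, digit_sum, digit_val_nsmul, digit_g]

theorem digit_shiftPoint_neg {s : ℕ} (a : Fin s → ZMod p) (j : Fin s) :
    V.digit (V.shiftPoint a) (-1 - (j : ℤ)) = a j := by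
  rw [digit_shiftPoint, Finset.sum_eq_single j]
  · simp
  · intro i _ hi
    rw [if_neg]
    intro h
    exact hi (Fin.ext (by omega))
  · simp

theorem digit_shiftPoint_of_nonneg {s : ℕ} (a : Fin s → ZMod p) {n : ℤ} (hn : 0 ≤ n) :
    V.digit (V.shiftPoint a) n = 0 := by
  rw [digit_shiftPoint]
  exact Finset.sum_eq_zero fun j _ => if_neg (by omega)

theorem digit_shiftPoint_of_lt {s : ℕ} (a : Fin s → ZMod p) {n : ℤ} (hn : n < -(s : ℤ)) :
    V.digit (V.shiftPoint a) n = 0 := by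
  rw [digit_shiftPoint]
  exact Finset.sum_eq_zero fun j _ => if_neg (by omega)

/-- An expansion has only finitely many non-zero digits at negative indices, so the finiteness built
into `H₀` is automatic. The digit criterion shows that `H₀` is a group. -/
theorem mem_H₀_iff {h : G} : h ∈ V.H₀ ↔ ∀ n, 0 ≤ n → V.digit h n = 0 := by
  constructor
  · rintro ⟨s, a, rfl⟩ n hn
    exact V.digit_shiftPoint_of_nonneg a hn
  · intro hh
    obtain ⟨m, hm⟩ := (V.isExpansion_digit h).1
    refine ⟨m.natAbs, fun j => V.digit h (-1 - (j : ℤ)), V.ext_digit fun n => ?_⟩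
    rcases lt_or_ge n 0 with hn | hn
    · by_cases hnm : n < -(m.natAbs : ℤ)
      · rw [digit_shiftPoint_of_lt _ _ hnm, hm _ (by omega)]
      · have h1 : n = -1 - (((⟨(-1 - n).toNat, by omega⟩ : Fin m.natAbs) : ℕ) : ℤ) := by
          simp only; omega
        rw [h1, digit_shiftPoint_neg]
    · rw [hh n hn, V.digit_shiftPoint_of_nonneg _ hn]

theorem add_mem_H₀ {h k : G} (hh : h ∈ V.H₀) (hk : k ∈ V.H₀) : h + k ∈ V.H₀ :=
  V.mem_H₀_iff.2 fun n hn => by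
    rw [digit_add, V.mem_H₀_iff.1 hh n hn, V.mem_H₀_iff.1 hk n hn, add_zero]

theorem neg_mem_H₀ {h : G} (hh : h ∈ V.H₀) : -h ∈ V.H₀ :=
  V.mem_H₀_iff.2 fun n hn => by rw [digit_neg, V.mem_H₀_iff.1 hh n hn, neg_zero]

theorem sub_mem_H₀ {h k : G} (hh : h ∈ V.H₀) (hk : k ∈ V.H₀) : h - k ∈ V.H₀ := by
  rw [sub_eq_add_neg]
  exact V.add_mem_H₀ hh (V.neg_mem_H₀ hk)

theorem dil_one_mem_H₀ {h : G} (hh : h ∈ V.H₀) : V.dil 1 h ∈ V.H₀ :=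
  V.mem_H₀_iff.2 fun n hn => by rw [digit_dil, V.mem_H₀_iff.1 hh _ (by omega)]

theorem val_smul_g_mem_H₀ (c : ZMod p) : c.val • V.g (-1) ∈ V.H₀ :=
  V.mem_H₀_iff.2 fun n hn => by rw [digit_val_nsmul, digit_g, if_neg (by omega), mul_zero]

/-- Keep the digits of `x` at negative indices and drop the others. -/
theorem exists_mem_H₀_sub_mem (x : G) : ∃ h ∈ V.H₀, x - h ∈ V.sub 0 := by
  obtain ⟨m, hm⟩ := (V.isExpansion_digit x).1
  obtain ⟨y, hy⟩ := V.exists_of_digits (a := fun n => if n < 0 then V.digit x n else 0) (m := m)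
    fun n hn => by simp [hm n hn]
  refine ⟨y, V.mem_H₀_iff.2 fun n hn => ?_, (V.mem_sub_iff _ _).2 fun n hn => ?_⟩
  · simp only [V.digit_eq hy, if_neg hn.not_gt]
  · simp only [digit_sub, V.digit_eq hy, if_pos hn, sub_self]

theorem dil_mem_sub_iff {k n : ℤ} {x : G} : V.dil k x ∈ V.sub n ↔ x ∈ V.sub (n + k) := by
  rw [mem_sub_iff, mem_sub_iff]
  refine ⟨fun h m hm => ?_, fun h m hm => ?_⟩
  · simpa [digit_dil] using h (m - k) (by omega)
  · rw [digit_dil]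
    exact h _ (by omega)

theorem dil_dil_neg (k : ℤ) (x : G) : V.dil k (V.dil (-k) x) = x := by
  rw [← dil_add, add_neg_cancel, dil_zero]

end Digits

/-! ### Elementary properties of characters -/

section Characters

variable {G : Type*} [AddCommGroup G] [TopologicalSpace G]
theorem pairing_add (χ : PontryaginDual (Multiplicative G)) (x y : G) :
    pairing χ (x + y) = pairing χ x * pairing χ y := by
  rw [pairing, ofAdd_add, map_mul, Circle.coe_mul, pairing, pairing]

theorem pairing_mul (χ ξ : PontryaginDual (Multiplicative G)) (x : G) :
    pairing (χ * ξ) x = pairing χ x * pairing ξ x := by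
  rfl

theorem pairing_inv (χ : PontryaginDual (Multiplicative G)) (x : G) :
    pairing χ⁻¹ x = (starRingEnd ℂ) (pairing χ x) :=
  Circle.coe_inv_eq_conj _

theorem norm_pairing (χ : PontryaginDual (Multiplicative G)) (x : G) : ‖pairing χ x‖ = 1 :=
  Circle.norm_coe _

theorem continuous_pairing (χ : PontryaginDual (Multiplicative G)) : Continuous (pairing χ) :=
  continuous_subtype_val.comp ((map_continuous χ).comp continuous_ofAdd)

/-- A character of `G` as a complex valued additive character. -/
noncomputable def pairingChar (χ : PontryaginDual (Multiplicative G)) : AddChar G ℂ where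
  toFun := pairing χ
  map_zero_eq_one' := by simp [pairing]
  map_add_eq_mul' := pairing_add χ

theorem pairing_zero (χ : PontryaginDual (Multiplicative G)) : pairing χ 0 = 1 :=
  (pairingChar χ).map_zero_eq_one

theorem pairing_nsmul (χ : PontryaginDual (Multiplicative G)) (n : ℕ) (x : G) :
    pairing χ (n • x) = pairing χ x ^ n :=
  (pairingChar χ).map_nsmul_eq_pow n x

theorem pairing_sum (χ : PontryaginDual (Multiplicative G)) {ι : Type*} (s : Finset ι)
    (x : ι → G) : pairing χ (∑ i ∈ s, x i) = ∏ i ∈ s, pairing χ (x i) := by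
  classical
  induction s using Finset.induction_on with
  | empty => simp [pairing_zero]
  | insert i s hi ih => rw [Finset.sum_insert hi, Finset.prod_insert hi, pairing_add, ih]

end Characters
-- Frequencies of characters
section Frequencies

variable {p : ℕ} [Fact p.Prime] {G : Type*} [AddCommGroup G] [TopologicalSpace G]
  (V : VilenkinGroup p G)

theorem sum_stdAddChar_mul (b : ZMod p) :
    ∑ a : ZMod p, ZMod.stdAddChar (a * b) = if b = 0 then (p : ℂ) else 0 := by
  have := AddChar.sum_mulShift b (ZMod.isPrimitive_stdAddChar p)
  rw [ZMod.card] at this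
  rw [this]
  split_ifs <;> simp

/-- Since p g_n = 0, the value is a p-th root of unity. -/
theorem exists_stdAddChar_eq (χ : PontryaginDual (Multiplicative G)) (n : ℤ) :
    ∃ a : ZMod p, ZMod.stdAddChar a = pairing χ (V.g n) := by
  have hp : p ≠ 0 := (Fact.out : p.Prime).ne_zero
  have h1 : pairing χ (V.g n) ^ p = 1 := by
    rw [← pairing_nsmul, V.smul_g, pairing_zero]
  have : NeZero p := ⟨hp⟩
  obtain ⟨i, -, hi⟩ := (Complex.isPrimitiveRoot_exp p hp).eq_pow_of_pow_eq_one h1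
  refine ⟨(i : ZMod p), ?_⟩
  rw [← hi, ← Complex.exp_nat_mul]
  have := ZMod.stdAddChar_coe (N := p) i
  push_cast at this
  rw [this]
  congr 1
  ring

/-- The `n`-th frequency of a character `χ`: the exponent `a` with `(χ, g_n) = exp (2πia/p)`. -/
noncomputable def freq (χ : PontryaginDual (Multiplicative G)) (n : ℤ) : ZMod p :=
  (V.exists_stdAddChar_eq χ n).choose

theorem pairing_g (χ : PontryaginDual (Multiplicative G)) (n : ℤ) :
    pairing χ (V.g n) = ZMod.stdAddChar (V.freq χ n) :=
  (V.exists_stdAddChar_eq χ n).choose_spec.symm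

theorem freq_eq {χ : PontryaginDual (Multiplicative G)} {n : ℤ} {a : ZMod p}
    (h : pairing χ (V.g n) = ZMod.stdAddChar a) : V.freq χ n = a :=
  ZMod.injective_stdAddChar ((V.pairing_g χ n).symm.trans h)

theorem pairing_val_smul_g (χ : PontryaginDual (Multiplicative G)) (n : ℤ) (c : ZMod p) :
    pairing χ (c.val • V.g n) = ZMod.stdAddChar (c * V.freq χ n) := by
  rw [pairing_nsmul, pairing_g, ← AddChar.map_nsmul_eq_pow, nsmul_eq_mul, ZMod.natCast_zmod_val]

theorem freq_mul (χ ξ : PontryaginDual (Multiplicative G)) (n : ℤ) :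
    V.freq (χ * ξ) n = V.freq χ n + V.freq ξ n :=
  V.freq_eq (by rw [pairing_mul, pairing_g, pairing_g, AddChar.map_add_eq_mul])

theorem freq_one (n : ℤ) : V.freq (1 : PontryaginDual (Multiplicative G)) n = 0 := by
  have := V.freq_mul (1 : PontryaginDual (Multiplicative G)) 1 n
  rwa [mul_one, left_eq_add] at this

theorem freq_inv (χ : PontryaginDual (Multiplicative G)) (n : ℤ) :
    V.freq χ⁻¹ n = -V.freq χ n := by
  rw [eq_neg_iff_add_eq_zero, ← freq_mul, inv_mul_cancel, freq_one]

variable [IsTopologicalAddGroup G]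

theorem freq_charDil (χ : PontryaginDual (Multiplicative G)) (k n : ℤ) :
    V.freq (V.charDil χ k) n = V.freq χ (n - k) := by
  refine V.freq_eq ?_
  rw [pairing_charDil, ← pairing_g]
  congr 1
  refine V.ext_digit fun m => ?_
  rw [digit_dil, digit_g, digit_g]
  exact if_congr (by omega) rfl rfl

/-- Each `x` is a limit of finite digit sums, on which a character is determined by its frequencies;
the set where it equals 1 is closed. -/
theorem mem_annihilator_iff {χ : PontryaginDual (Multiplicative G)} {k : ℤ} :
    χ ∈ V.annihilator k ↔ ∀ n, k ≤ n → V.freq χ n = 0 := by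
  constructor
  · intro h n hn
    refine V.freq_eq ?_
    rw [h _ (V.sub_antitone hn (V.g_mem n)), AddChar.map_zero_eq_one]
  · intro h x hx
    refine (isClosed_singleton.preimage (continuous_pairing χ)).mem_of_tendsto
      (V.isExpansion_digit x).2 (Eventually.of_forall fun F => ?_)
    rw [mem_preimage, mem_singleton_iff]
    refine (pairing_sum χ F _).trans (Finset.prod_eq_one fun n _ => ?_)
    refine (V.pairing_val_smul_g χ n _).trans ?_
    rcases lt_or_ge n k with hn | hn
    · rw [V.digit_eq_zero_of_mem hx hn, zero_mul, AddChar.map_zero_eq_one]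
    · rw [h n hn, mul_zero, AddChar.map_zero_eq_one]

theorem pairing_shiftPoint_two (χ : PontryaginDual (Multiplicative G)) (a : Fin 2 → ZMod p) :
    pairing χ (V.shiftPoint a) =
      ZMod.stdAddChar (a 0 * V.freq χ (-1) + a 1 * V.freq χ (-2)) := by
  rw [shiftPoint, Fin.sum_univ_two, pairing_add, AddChar.map_add_eq_mul, pairing_val_smul_g,
    pairing_val_smul_g]
  norm_num

/-- The character `x ↦ exp (2πi/p ∑_{i < L} c_i d_{i-1}(x))`, where `d_n` is the `n`-th digit. -/
noncomputable def digitChar (L : ℕ) (c : ℕ → ZMod p) : PontryaginDual (Multiplicative G) :=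
  let F : Multiplicative G →* Circle :=
    { toFun := fun y => ZMod.toCircle (∑ i ∈ Finset.range L, c i * V.digit y.toAdd ((i : ℤ) - 1))
      map_one' := by simp [digit_zero]
      map_mul' := fun y z => by
        simp [digit_add, mul_add, Finset.sum_add_distrib, AddChar.map_add_eq_mul] }
  { F with
    continuous_toFun := by
      refine continuous_of_continuousAt_one F ?_
      -- Only digits of index below `L` enter, so the character is trivial on the open subgroup
      -- `V.sub L`.
      refine ContinuousAt.congr (f := fun _ => 1) continuousAt_const ?_
      have : Multiplicative.toAdd ⁻¹' (V.sub L : Set G) ∈ 𝓝 (1 : Multiplicative G) :=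
        ((V.isOpen_sub L).preimage continuous_toAdd).mem_nhds (V.sub L).zero_mem
      filter_upwards [this] with y hy
      have h0 : ∑ i ∈ Finset.range L, c i * V.digit y.toAdd ((i : ℤ) - 1) = 0 := by
        refine Finset.sum_eq_zero fun i hi => ?_
        rw [V.digit_eq_zero_of_mem (x := y.toAdd) hy
          (by rw [Finset.mem_range] at hi; omega), mul_zero]
      change 1 = ZMod.toCircle (∑ i ∈ Finset.range L, c i * V.digit y.toAdd ((i : ℤ) - 1))
      rw [h0, AddChar.map_zero_eq_one] }

theorem pairing_digitChar (L : ℕ) (c : ℕ → ZMod p) (x : G) :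
    pairing (V.digitChar L c) x =
      ZMod.stdAddChar (∑ i ∈ Finset.range L, c i * V.digit x ((i : ℤ) - 1)) := rfl

theorem freq_digitChar (L : ℕ) (c : ℕ → ZMod p) (i : ℕ) :
    V.freq (V.digitChar L c) ((i : ℤ) - 1) = if i < L then c i else 0 := by
  refine V.freq_eq ?_
  rw [pairing_digitChar]
  congr 1
  simp [digit_g]

end Frequencies

/-! ### Haar measure and character integrals -/

section Measure

variable {p : ℕ} [Fact p.Prime] {G : Type*} [AddCommGroup G] [TopologicalSpace G]
  [IsTopologicalAddGroup G] (V : VilenkinGroup p G)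

include V in
theorem locallyCompactSpace : LocallyCompactSpace G :=
  (V.isCompact_sub 0).locallyCompactSpace_of_mem_nhds_of_addGroup
    ((V.isOpen_sub 0).mem_nhds (V.sub 0).zero_mem)

variable [MeasurableSpace G] [BorelSpace G]

instance isAddHaarMeasure_μ : V.μ.IsAddHaarMeasure := by
  unfold μ; infer_instance

theorem regular_μ : V.μ.Regular := by
  have := V.locallyCompactSpace
  unfold μ; infer_instance

theorem measurableSet_sub (n : ℤ) : MeasurableSet (V.sub n : Set G) :=
  (V.isOpen_sub n).measurableSet

theorem μ_sub_zero : V.μ (V.sub 0 : Set G) = 1 :=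
  Measure.addHaarMeasure_self (K₀ := V.unitBall)

theorem μ_sub_lt_top (n : ℤ) : V.μ (V.sub n : Set G) < ⊤ := (V.isCompact_sub n).measure_lt_top

theorem μ_sub_neg_one : V.μ (V.sub (-1) : Set G) = p := by
  have hU : (V.sub (-1) : Set G) =
      ⋃ c : ZMod p, (fun x => -(c.val • V.g (-1)) + x) ⁻¹' (V.sub 0 : Set G) := by
    ext x
    simp only [mem_iUnion, mem_preimage, SetLike.mem_coe]
    constructor
    · intro hx
      obtain ⟨c, hc⟩ := V.exists_digit hx
      exact ⟨c, by rwa [neg_add_eq_sub]⟩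
    · rintro ⟨c, hc⟩
      have := add_mem (V.sub_antitone (by norm_num : (-1 : ℤ) ≤ 0) hc)
        (nsmul_mem (V.g_mem (-1)) c.val)
      simpa using this
  rw [hU, measure_iUnion]
  · simp [measure_preimage_add, μ_sub_zero]
  · intro a b hab
    refine Set.disjoint_left.2 fun x hx hy => hab ?_
    have h1 := V.digit_eq_zero_of_mem hx (n := -1) (by norm_num)
    have h2 := V.digit_eq_zero_of_mem hy (n := -1) (by norm_num)
    rw [digit_add, digit_neg, digit_val_nsmul, digit_g, if_pos rfl, mul_one,
      neg_add_eq_zero] at h1 h2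
    exact h1.trans h2.symm
  · exact fun c => (V.measurableSet_sub 0).preimage (measurable_const_add _)

theorem setIntegral_pairing (χ : PontryaginDual (Multiplicative G))
    [Decidable (χ ∈ V.annihilator (-1))] :
    ∫ x in (V.sub (-1) : Set G), pairing χ x ∂V.μ =
      if χ ∈ V.annihilator (-1) then (p : ℂ) else 0 := by
  split_ifs with h
  · rw [setIntegral_congr_fun (g := fun _ => 1) (V.measurableSet_sub _) fun x hx => h x hx]
    simp [Measure.real, μ_sub_neg_one]
  -- Translation by such a `y` preserves the integral but multiplies it by `pairing χ y ≠ 1`.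
  · have h' : ∃ y ∈ V.sub (-1), pairing χ y ≠ 1 := by
      simpa [annihilator] using h
    obtain ⟨y, hy, hχ⟩ := h'
    rw [← integral_indicator (V.measurableSet_sub _)]
    have h1 := integral_add_right_eq_self (μ := V.μ)
      (indicator (V.sub (-1) : Set G) (pairing χ)) y
    have h2 : ∀ x, indicator (V.sub (-1) : Set G) (pairing χ) (x + y) =
        indicator (V.sub (-1) : Set G) (pairing χ) x * pairing χ y := by
      intro x
      by_cases hx : x ∈ V.sub (-1)
      · rw [indicator_of_mem (add_mem hx hy : x + y ∈ V.sub (-1)), indicator_of_mem hx,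
          pairing_add]
      · rw [indicator_of_notMem, indicator_of_notMem hx, zero_mul]
        exact fun h => hx (by simpa using sub_mem h hy)
    simp_rw [h2] at h1
    rw [integral_mul_const] at h1
    by_contra h0
    exact hχ (mul_left_cancel₀ h0 (h1.trans (mul_one _).symm))

end Measure
-- The refinable function of a tree
section Tree

variable {p : ℕ} [Fact p.Prime] {G : Type*} [AddCommGroup G] [TopologicalSpace G]
  [IsTopologicalAddGroup G] (V : VilenkinGroup p G)

theorem freq_digitChar_of_lt (L : ℕ) (c : ℕ → ZMod p) {n : ℤ} (hn : n < -1) :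
    V.freq (V.digitChar L c) n = 0 := by
  refine V.freq_eq ?_
  rw [pairing_digitChar]
  congr 1
  refine Finset.sum_eq_zero fun i _ => ?_
  rw [digit_g, if_neg (by omega), mul_zero]

/-- The character whose frequencies at `-1, 0, 1, …` are `a, f a, f (f a), …` (up to the first `L`
of them). -/
noncomputable def orbitChar (f : ZMod p → ZMod p) (L : ℕ) (a : ZMod p) :
    PontryaginDual (Multiplicative G) :=
  V.digitChar L fun i => f^[i] a

/-- The refinable function attached to a map `f` on `ZMod p` all of whose orbits
reach `0` within `L` steps: its Fourier transform is the indicator function of the set of characters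
whose frequencies satisfy `x_j = f x_{j-1}` for `j ≥ 0`. -/
noncomputable def treeScaling (f : ZMod p → ZMod p) (L : ℕ) : G → ℂ :=
  indicator (V.sub (-1) : Set G) fun x => (1 / (p : ℂ)) * ∑ a, pairing (V.orbitChar f L a) x

/-- The refinement coefficients of `treeScaling f L`. -/
noncomputable def treeCoeff (f : ZMod p → ZMod p) (a : Fin 2 → ZMod p) : ℂ :=
  (1 / (p : ℂ)) * ∑ u, ZMod.stdAddChar (a 0 * f u + a 1 * u)

theorem natCast_ne_zero_of_prime (p : ℕ) [Fact p.Prime] : (p : ℂ) ≠ 0 :=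
  Nat.cast_ne_zero.2 (Fact.out : p.Prime).ne_zero

theorem conj_stdAddChar (a : ZMod p) :
    (starRingEnd ℂ) (ZMod.stdAddChar a) = ZMod.stdAddChar (-a) := by
  rw [ZMod.stdAddChar_apply, ZMod.stdAddChar_apply, AddChar.map_neg_eq_inv, Circle.coe_inv_eq_conj]

theorem pairing_sub (χ : PontryaginDual (Multiplicative G)) (x y : G) :
    pairing χ (x - y) = pairing χ x * (starRingEnd ℂ) (pairing χ y) := by
  have h := pairing_add χ (x - y) y
  rw [sub_add_cancel] at h
  rw [h, mul_assoc, Complex.mul_conj', norm_pairing]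
  simp

variable {f : ZMod p → ZMod p} {L : ℕ}

theorem iterate_eq_zero_of_le (hf : ∀ a, f^[L] a = 0) {i : ℕ} (hi : L ≤ i) (a : ZMod p) :
    f^[i] a = 0 := by
  obtain ⟨k, rfl⟩ := Nat.exists_eq_add_of_le hi
  rw [Function.iterate_add_apply, hf]

/-- f 0 = f (f^L 0) = f^L (f 0) = 0. -/
theorem apply_zero_of_iterate (hf : ∀ a, f^[L] a = 0) : f 0 = 0 := by
  rw [← hf 0, ← Function.iterate_succ_apply' f, Function.iterate_succ_apply, hf, hf]

/-- Cutting the orbit off after `L` terms loses nothing, as all later iterates vanish. -/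
theorem freq_orbitChar (hf : ∀ a, f^[L] a = 0) (a : ZMod p) (i : ℕ) :
    V.freq (V.orbitChar f L a) ((i : ℤ) - 1) = f^[i] a := by
  rw [orbitChar, freq_digitChar]
  split_ifs with h
  · rfl
  · exact (iterate_eq_zero_of_le hf (not_lt.1 h) a).symm

theorem freq_orbitChar_neg_one (hf : ∀ a, f^[L] a = 0) (a : ZMod p) :
    V.freq (V.orbitChar f L a) (-1) = a := by
  simpa using V.freq_orbitChar hf a 0

theorem orbitChar_mem_annihilator (hf : ∀ a, f^[L] a = 0) (a : ZMod p) :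
    V.orbitChar f L a ∈ V.annihilator (L - 1) :=
  V.mem_annihilator_iff.2 fun n hn => by
    obtain ⟨i, rfl⟩ : ∃ i : ℕ, n = (i : ℤ) - 1 := ⟨(n + 1).toNat, by omega⟩
    rw [V.freq_orbitChar hf, iterate_eq_zero_of_le hf (by omega)]

theorem treeScaling_add_mem (hf : ∀ a, f^[L] a = 0) (x : G) {y : G} (hy : y ∈ V.sub (L - 1)) :
    V.treeScaling f L (x + y) = V.treeScaling f L x := by
  have hy' : y ∈ V.sub (-1) := V.sub_antitone (by omega) hy
  by_cases hx : x ∈ V.sub (-1)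
  · rw [treeScaling, indicator_of_mem hx, indicator_of_mem (add_mem hx hy' : x + y ∈ V.sub (-1))]
    simp [pairing_add, V.orbitChar_mem_annihilator hf _ y hy]
  · rw [treeScaling, indicator_of_notMem hx, indicator_of_notMem]
    exact fun h => hx (by simpa using sub_mem h hy')

theorem isClopen_sub (n : ℤ) : IsClopen (V.sub n : Set G) :=
  ⟨(V.sub n).isClosed_of_isOpen (V.isOpen_sub n), V.isOpen_sub n⟩

theorem continuous_treeScaling (f : ZMod p → ZMod p) (L : ℕ) : Continuous (V.treeScaling f L) := by
  refine Continuous.indicator (by simp [(V.isClopen_sub (-1)).frontier_eq]) ?_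
  exact continuous_const.mul (continuous_finsetSum _ fun a _ => continuous_pairing _)

theorem tsupport_treeScaling_subset (f : ZMod p → ZMod p) (L : ℕ) :
    tsupport (V.treeScaling f L) ⊆ V.sub (-1) :=
  closure_minimal support_indicator_subset (V.isClopen_sub (-1)).1

theorem hasCompactSupport_treeScaling (f : ZMod p → ZMod p) (L : ℕ) :
    HasCompactSupport (V.treeScaling f L) :=
  (V.isCompact_sub (-1)).of_isClosed_subset (isClosed_tsupport _)
    (V.tsupport_treeScaling_subset f L)

/-- Dilation moves the digit of `x` at -1 to -2, where `a 1` has to cancel it; `a 0` sits at -1 and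
is unconstrained. -/
theorem dil_sub_shiftPoint_mem_iff (x : G) (a : Fin 2 → ZMod p) :
    V.dil 1 x - V.shiftPoint a ∈ V.sub (-1) ↔ x ∈ V.sub (-1) ∧ a 1 = V.digit x (-1) := by
  have h2 : V.digit (V.shiftPoint a) (-2) = a 1 := V.digit_shiftPoint_neg a 1
  rw [mem_sub_iff, mem_sub_iff]
  simp only [digit_sub, digit_dil]
  constructor
  · intro h
    refine ⟨fun n hn => ?_, ?_⟩
    · have := h (n - 1) (by omega)
      rwa [V.digit_shiftPoint_of_lt _ (by push_cast; omega), sub_zero, sub_add_cancel] at this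
    · have := h (-2) (by omega)
      rw [h2] at this
      exact (sub_eq_zero.1 this).symm
  · rintro ⟨h, ha⟩ n hn
    rcases eq_or_ne n (-2) with rfl | hn2
    · rw [h2, ha]
      exact sub_self _
    · rw [h _ (by omega), V.digit_shiftPoint_of_lt _ (by push_cast; omega), sub_zero]

/-- The orbit of `u` is `u` followed by the orbit of `f u`, and dilation shifts digits by one place.
This is the refinement equation for a single character. -/
theorem pairing_orbitChar_dil (hf : ∀ a, f^[L] a = 0) (u : ZMod p) (x : G) :
    ZMod.stdAddChar (V.digit x (-1) * u) * pairing (V.orbitChar f L (f u)) (V.dil 1 x) =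
      pairing (V.orbitChar f L u) x := by
  rw [orbitChar, pairing_digitChar, orbitChar, pairing_digitChar, ← AddChar.map_add_eq_mul]
  congr 1
  have h1 := Finset.sum_range_succ (fun i => f^[i] u * V.digit x ((i : ℤ) - 1)) L
  -- The sum over `L + 1` terms is read in two ways: its last term is zero, and its first term
  -- splits off.
  rw [hf, zero_mul, add_zero, Finset.sum_range_succ'] at h1
  rw [← h1, add_comm]
  simp [digit_dil, mul_comm]

theorem satisfiesRefinement_treeScaling (hf : ∀ a, f^[L] a = 0) :
    V.SatisfiesRefinement 2 (treeCoeff f) (V.treeScaling f L) := by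
  intro x
  have hp := natCast_ne_zero_of_prime p
  by_cases hx : x ∈ V.sub (-1)
  · rw [← (finTwoArrowEquiv (ZMod p)).symm.sum_comp, Fintype.sum_prod_type]
    have h1 : ∀ a : ZMod p, ∑ b, treeCoeff f ((finTwoArrowEquiv (ZMod p)).symm (a, b)) *
          V.treeScaling f L (V.dil 1 x - V.shiftPoint ((finTwoArrowEquiv (ZMod p)).symm (a, b))) =
        (1 / (p : ℂ)) ^ 2 * ∑ u, ∑ v, ZMod.stdAddChar (V.digit x (-1) * u) *
          pairing (V.orbitChar f L v) (V.dil 1 x) * ZMod.stdAddChar (a * (f u - v)) := by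
      intro a
      -- The support of `treeScaling` leaves only one value of the second coordinate.
      rw [Finset.sum_eq_single (V.digit x (-1))]
      · rw [treeScaling, indicator_of_mem ((V.dil_sub_shiftPoint_mem_iff _ _).2 ⟨hx, rfl⟩),
          treeCoeff, mul_mul_mul_comm, Finset.sum_mul_sum, ← sq]
        congr 1
        refine Finset.sum_congr rfl fun u _ => Finset.sum_congr rfl fun v _ => ?_
        rw [pairing_sub, pairing_shiftPoint_two, V.freq_orbitChar_neg_one hf, orbitChar,
          V.freq_digitChar_of_lt L _ (by norm_num), conj_stdAddChar]
        simp only [finTwoArrowEquiv_symm_apply, Matrix.cons_val_zero, Matrix.cons_val_one]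
        rw [mul_left_comm, ← AddChar.map_add_eq_mul, mul_comm (ZMod.stdAddChar _), mul_assoc,
          ← AddChar.map_add_eq_mul]
        congr 2
        ring
      · intro b _ hb
        rw [treeScaling, indicator_of_notMem, mul_zero]
        exact fun h => hb ((V.dil_sub_shiftPoint_mem_iff _ _).1 h).2
      · simp
    simp_rw [h1]
    rw [← Finset.mul_sum, Finset.sum_comm]
    have h2 : ∀ u, ∑ a : ZMod p, ∑ v, ZMod.stdAddChar (V.digit x (-1) * u) *
          pairing (V.orbitChar f L v) (V.dil 1 x) * ZMod.stdAddChar (a * (f u - v)) =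
        p * pairing (V.orbitChar f L u) x := by
      intro u
      rw [Finset.sum_comm]
      simp_rw [← Finset.mul_sum, sum_stdAddChar_mul]
      -- Summation over the first coordinate selects the orbit starting at `f u`.
      rw [Finset.sum_eq_single (f u)]
      · rw [sub_self, if_pos rfl, V.pairing_orbitChar_dil hf, mul_comm]
      · intro v _ hv
        rw [if_neg (sub_ne_zero.2 hv.symm), mul_zero]
      · simp
    simp_rw [h2]
    rw [treeScaling, indicator_of_mem hx, ← Finset.mul_sum]
    field_simp
  · rw [treeScaling, indicator_of_notMem hx]
    refine (Finset.sum_eq_zero fun a _ => ?_).symm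
    rw [indicator_of_notMem, mul_zero]
    exact fun h => hx ((V.dil_sub_shiftPoint_mem_iff _ _).1 h).1

/-- The coefficients are, up to scaling, the Fourier transform on (ZMod p)² of the indicator of the
graph of `f`, and the mask inverts it. The two factors `1 / p` cancel the two character sums. -/
theorem mask_treeCoeff (f : ZMod p → ZMod p) (χ : PontryaginDual (Multiplicative G)) :
    V.mask 2 (treeCoeff f) χ = if V.freq χ 0 = f (V.freq χ (-1)) then 1 else 0 := by
  have hp := natCast_ne_zero_of_prime p
  rw [mask, ← (finTwoArrowEquiv (ZMod p)).symm.sum_comp, Fintype.sum_prod_type]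
  have h1 : ∀ a b : ZMod p, treeCoeff f ((finTwoArrowEquiv (ZMod p)).symm (a, b)) *
        (starRingEnd ℂ) (pairing (V.charDil χ (-1))
          (V.shiftPoint ((finTwoArrowEquiv (ZMod p)).symm (a, b)))) =
      (1 / (p : ℂ)) * ∑ u, ZMod.stdAddChar (a * (f u - V.freq χ 0)) *
        ZMod.stdAddChar (b * (u - V.freq χ (-1))) := by
    intro a b
    rw [treeCoeff, mul_assoc, Finset.sum_mul, pairing_shiftPoint_two, freq_charDil, freq_charDil,
      conj_stdAddChar]
    congr 1
    refine Finset.sum_congr rfl fun u _ => ?_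
    simp only [finTwoArrowEquiv_symm_apply, Matrix.cons_val_zero, Matrix.cons_val_one]
    rw [← AddChar.map_add_eq_mul, ← AddChar.map_add_eq_mul]
    congr 1
    norm_num
    ring
  simp_rw [h1, ← Finset.mul_sum]
  have h2 : ∀ a : ZMod p, ∑ b, ∑ u, ZMod.stdAddChar (a * (f u - V.freq χ 0)) *
        ZMod.stdAddChar (b * (u - V.freq χ (-1))) =
      p * ZMod.stdAddChar (a * (f (V.freq χ (-1)) - V.freq χ 0)) := by
    intro a
    rw [Finset.sum_comm]
    simp_rw [← Finset.mul_sum, sum_stdAddChar_mul]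
    rw [Finset.sum_eq_single (V.freq χ (-1))]
    · rw [sub_self, if_pos rfl, mul_comm]
    · intro v _ hv
      rw [if_neg (sub_ne_zero.2 hv), mul_zero]
    · simp
  simp_rw [h2, ← Finset.mul_sum, sum_stdAddChar_mul, sub_eq_zero, eq_comm (a := f _)]
  split_ifs
  · field_simp
  · simp

theorem isElementary_treeCoeff (hf : f 0 = 0) : V.IsElementary 1 (V.mask 2 (treeCoeff f)) := by
  constructor
  · intro χ ξ hξ
    have h := V.mem_annihilator_iff.1 hξ
    simp only [mask_treeCoeff, freq_mul, h 0 (by norm_num), h (-1) (by norm_num), add_zero]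
  · ext r
    simp only [mask_treeCoeff, mem_range, mem_insert_iff, mem_singleton_iff]
    constructor
    · rintro ⟨χ, rfl⟩
      split_ifs <;> simp
    · rintro (rfl | rfl)
      -- This character has frequencies 0 at -1 and 1 at 0, so it violates `x_0 = f x_{-1}` because
      -- `f 0 = 0`.
      · refine ⟨V.digitChar 2 fun i => (i : ZMod p), ?_⟩
        have h0 := V.freq_digitChar 2 (fun i => (i : ZMod p)) 0
        have h1 := V.freq_digitChar 2 (fun i => (i : ZMod p)) 1
        norm_num at h0 h1
        rw [h0, h1, hf, if_neg one_ne_zero, norm_zero]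
      · refine ⟨1, ?_⟩
        rw [freq_one, freq_one, hf, if_pos rfl, norm_one]

variable [MeasurableSpace G] [BorelSpace G]

theorem memLp_treeScaling (f : ZMod p → ZMod p) (L : ℕ) (q : ENNReal) :
    MemLp (V.treeScaling f L) q V.μ :=
  (V.continuous_treeScaling f L).memLp_of_hasCompactSupport (V.hasCompactSupport_treeScaling f L)

theorem isStep_treeScaling (hf : ∀ a, f^[L] a = 0) :
    V.IsStep (L - 1) 1 (V.treeScaling f L) where
  memLp := V.memLp_treeScaling f L 2
  support_subset := V.tsupport_treeScaling_subset f L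
  const_on_cosets x _ hy := V.treeScaling_add_mem hf x hy

-- Integration over G_{-1} counts the `a` for which `orbitChar f L a` and `χ` agree modulo the
-- annihilator of G_{-1}. The frequency at -1 forces `a = V.freq χ (-1)`, so the count is 0 or 1.
open Classical in
theorem fourier_treeScaling (hf : ∀ a, f^[L] a = 0) (χ : PontryaginDual (Multiplicative G)) :
    V.fourier (V.treeScaling f L) χ =
      if ∀ j : ℕ, V.freq χ j = f (V.freq χ ((j : ℤ) - 1)) then 1 else 0 := by
  have hp := natCast_ne_zero_of_prime p
  have h1 : V.fourier (V.treeScaling f L) χ =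
      ∑ a, if V.orbitChar f L a * χ⁻¹ ∈ V.annihilator (-1) then (1 : ℂ) else 0 := by
    have h2 : ∀ x, V.treeScaling f L x * (starRingEnd ℂ) (pairing χ x) =
        indicator (V.sub (-1) : Set G)
          (fun x => (1 / (p : ℂ)) * ∑ a, pairing (V.orbitChar f L a * χ⁻¹) x) x := by
      intro x
      by_cases hx : x ∈ (V.sub (-1) : Set G)
      · rw [treeScaling, indicator_of_mem hx, indicator_of_mem hx, mul_assoc, Finset.sum_mul]
        simp only [pairing_mul, pairing_inv]
      · rw [treeScaling, indicator_of_notMem hx, indicator_of_notMem hx, zero_mul]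
    simp_rw [fourier, h2]
    rw [integral_indicator (V.measurableSet_sub _), integral_const_mul, integral_finsetSum]
    · simp_rw [setIntegral_pairing, Finset.mul_sum]
      refine Finset.sum_congr rfl fun a _ => ?_
      split_ifs
      · field_simp
      · simp
    · have := V.t2Space
      exact fun a _ => (continuous_pairing _).continuousOn.integrableOn_compact (V.isCompact_sub _)
  have h3 : ∀ a, V.orbitChar f L a * χ⁻¹ ∈ V.annihilator (-1) ↔
      ∀ i : ℕ, V.freq χ ((i : ℤ) - 1) = f^[i] a := by
    intro a
    rw [mem_annihilator_iff]
    simp only [freq_mul, freq_inv]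
    constructor
    · intro h i
      have := h ((i : ℤ) - 1) (by omega)
      rw [V.freq_orbitChar hf, ← sub_eq_add_neg, sub_eq_zero] at this
      exact this.symm
    · intro h n hn
      obtain ⟨i, rfl⟩ : ∃ i : ℕ, n = (i : ℤ) - 1 := ⟨(n + 1).toNat, by omega⟩
      rw [V.freq_orbitChar hf, h, add_neg_cancel]
  rw [h1]
  simp only [h3]
  split_ifs with hχ
  · have h4 : ∀ i : ℕ, V.freq χ ((i : ℤ) - 1) = f^[i] (V.freq χ (-1)) := by
      intro i
      induction i with
      | zero => simp
      | succ i ih =>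
        rw [Function.iterate_succ_apply', ← ih, ← hχ]
        congr 1
        push_cast
        ring
    rw [Finset.sum_eq_single (V.freq χ (-1)), if_pos h4]
    · intro b _ hb
      refine if_neg fun h => hb ?_
      simpa using (h 0).symm
    · simp
  · refine Finset.sum_eq_zero fun a _ => if_neg fun h => hχ fun j => ?_
    have := h (j + 1)
    rw [Function.iterate_succ_apply', ← h j] at this
    rw [← this]
    congr 1
    push_cast
    ring

theorem fourier_treeScaling_orbitChar (hf : ∀ a, f^[L] a = 0) (a : ZMod p) :
    V.fourier (V.treeScaling f L) (V.orbitChar f L a) = 1 := by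
  classical
  rw [V.fourier_treeScaling hf, if_pos]
  intro j
  have := V.freq_orbitChar hf a (j + 1)
  rw [Function.iterate_succ_apply', ← V.freq_orbitChar hf] at this
  rw [← this]
  congr 1
  push_cast
  ring

/-- The j-th factor of the product tests `x_j = f x_{j-1}`. The partial products are therefore
constantly 1, or 0 from the first failure on. -/
theorem isElementaryRefinable_treeScaling (hf : ∀ a, f^[L] a = 0) :
    V.IsElementaryRefinable 1 (V.treeScaling f L) := by
  classical
  refine ⟨memLp_one_iff_integrable.1 (V.memLp_treeScaling f L 1), treeCoeff f,
    V.satisfiesRefinement_treeScaling hf, V.isElementary_treeCoeff (apply_zero_of_iterate hf),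
    fun χ => ?_⟩
  have h : ∀ j : ℕ, V.mask (1 + 1) (treeCoeff f) (V.charDil χ (-(j : ℤ))) =
      if V.freq χ j = f (V.freq χ ((j : ℤ) - 1)) then 1 else 0 := by
    intro j
    rw [mask_treeCoeff, freq_charDil, freq_charDil, zero_sub, neg_neg, sub_neg_eq_add,
      neg_add_eq_sub]
  simp_rw [h]
  rw [V.fourier_treeScaling hf]
  split_ifs with hχ
  · simp [← hχ]
  · obtain ⟨k, hk⟩ := not_forall.1 hχ
    refine tendsto_const_nhds.congr' ?_
    filter_upwards [eventually_gt_atTop k] with n hn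
    exact (Finset.prod_eq_zero (Finset.mem_range.2 hn) (if_neg hk)).symm

end Tree

/-! ### Linear combinations and closed spans in L² -/

theorem coeFn_sum_smul {α ι : Type*} [MeasurableSpace α] {ν : Measure α} (s : Finset ι)
    (c : ι → ℂ) (U : ι → Lp ℂ 2 ν) (u : ι → α → ℂ) (hU : ∀ i ∈ s, U i =ᵐ[ν] u i) :
    (∑ i ∈ s, c i • U i : Lp ℂ 2 ν) =ᵐ[ν] fun x => ∑ i ∈ s, c i * u i x := by
  have h : ∀ᵐ x ∂ν, ∀ i ∈ s, (c i • U i : Lp ℂ 2 ν) x = c i * u i x := by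
    refine (ae_ball_iff s.countable_toSet).2 fun i hi => ?_
    filter_upwards [Lp.coeFn_smul (c i) (U i), hU i hi] with x h1 h2
    rw [h1, Pi.smul_apply, h2, smul_eq_mul]
  filter_upwards [Lp.coeFn_fun_finsetSum s fun i => c i • U i, h] with x h1 h2
  exact h1.trans (Finset.sum_congr rfl h2)

theorem mem_of_ae_eq_sum {α ι : Type*} [MeasurableSpace α] {ν : Measure α}
    {W : Submodule ℂ (Lp ℂ 2 ν)} {s : Finset ι} {c : ι → ℂ} {U : ι → Lp ℂ 2 ν} {u : ι → α → ℂ}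
    (hU : ∀ i ∈ s, U i =ᵐ[ν] u i) (hW : ∀ i ∈ s, U i ∈ W) {F : Lp ℂ 2 ν}
    (hF : F =ᵐ[ν] fun x => ∑ i ∈ s, c i * u i x) : F ∈ W := by
  rw [Lp.ext (hF.trans (coeFn_sum_smul s c U u hU).symm)]
  exact sum_mem fun i hi => W.smul_mem _ (hW i hi)

theorem map_mem_closure_span {E : Type*} [NormedAddCommGroup E] [NormedSpace ℂ E]
    (T : E →L[ℂ] E) {S S' : Set E} (h : ∀ x ∈ S, T x ∈ S') {x : E}
    (hx : x ∈ (Submodule.span ℂ S).topologicalClosure) :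
    T x ∈ (Submodule.span ℂ S').topologicalClosure := by
  have h1 : Submodule.span ℂ S ≤ (Submodule.span ℂ S').comap (T : E →ₗ[ℂ] E) :=
    Submodule.span_le.2 fun y hy => Submodule.subset_span (h y hy)
  exact map_mem_closure T.continuous hx fun y hy => h1 hy

/-! ### Composition operators on L² -/

section Composition

variable {α : Type*} [MeasurableSpace α] {ν : Measure α} {T : α → α} {c : NNReal}

theorem memLp_comp_of_map_eq_smul (hT : Measurable T) (hc : ν.map T = c • ν) {f : α → ℂ}
    (hf : MemLp f 2 ν) : MemLp (f ∘ T) 2 ν := by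
  refine MemLp.comp_of_map ?_ hT.aemeasurable
  rw [hc]
  exact hf.smul_measure ENNReal.coe_ne_top

theorem ae_eq_comp_of_map_eq_smul (hT : Measurable T) (hc : ν.map T = c • ν) {f g : α → ℂ}
    (h : f =ᵐ[ν] g) : (fun x => f (T x)) =ᵐ[ν] fun x => g (T x) := by
  have hq : Measure.QuasiMeasurePreserving T ν ν :=
    ⟨hT, hc ▸ Measure.smul_absolutelyContinuous⟩
  exact hq.ae_eq_comp h

/-- Composition with a map that scales the measure, as an operator on `L²`. -/
noncomputable def compLp (hT : Measurable T) (hc : ν.map T = c • ν) :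
    Lp ℂ 2 ν →L[ℂ] Lp ℂ 2 ν :=
  let A : Lp ℂ 2 ν →ₗ[ℂ] Lp ℂ 2 ν :=
    { toFun := fun f => (memLp_comp_of_map_eq_smul hT hc (Lp.memLp f)).toLp
      map_add' := fun f g => by
        rw [← MemLp.toLp_add]
        exact MemLp.toLp_congr _ _ (ae_eq_comp_of_map_eq_smul hT hc (Lp.coeFn_add f g))
      map_smul' := fun a f => by
        rw [RingHom.id_apply, ← MemLp.toLp_const_smul]
        exact MemLp.toLp_congr _ _ (ae_eq_comp_of_map_eq_smul hT hc (Lp.coeFn_smul a f)) }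
  A.mkContinuous ((c : ENNReal) ^ (1 / (2 : ENNReal)).toReal).toReal fun f => by
    change ‖(memLp_comp_of_map_eq_smul hT hc (Lp.memLp f)).toLp‖ ≤ _
    rw [Lp.norm_toLp, Lp.norm_def, ← ENNReal.toReal_mul]
    refine ENNReal.toReal_mono ?_ ?_
    · exact ENNReal.mul_ne_top (ENNReal.rpow_ne_top_of_nonneg (by positivity)
        ENNReal.coe_ne_top) (Lp.eLpNorm_ne_top f)
    · have h : AEStronglyMeasurable f (ν.map T) := by
        rw [hc]
        exact (Lp.aestronglyMeasurable f).smul_measure _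
      rw [← eLpNorm_map_measure h hT.aemeasurable, hc]
      exact eLpNorm_smul_measure_le _ _ _ _

theorem coeFn_compLp (hT : Measurable T) (hc : ν.map T = c • ν) (f : Lp ℂ 2 ν) :
    compLp hT hc f =ᵐ[ν] fun x => f (T x) :=
  MemLp.coeFn_toLp (memLp_comp_of_map_eq_smul hT hc (Lp.memLp f))

end Composition

/-! ### Dilations and translations on L² -/

section Operators

variable {p : ℕ} [Fact p.Prime] {G : Type*} [AddCommGroup G] [TopologicalSpace G]
  [IsTopologicalAddGroup G] (V : VilenkinGroup p G) [MeasurableSpace G] [BorelSpace G]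

/-- Uniqueness of Haar measure; the value of the constant plays no role. -/
theorem exists_map_dil_eq_smul (k : ℤ) :
    ∃ c : NNReal, V.μ.map (V.dil k) = c • V.μ := by
  have := V.locallyCompactSpace
  have := V.regular_μ
  have : (V.μ.map (V.dil k)).IsAddHaarMeasure := ContinuousAddEquiv.isAddHaarMeasure_map V.μ _
  have : (V.μ.map (V.dil k)).Regular := Measure.Regular.map (V.dil k).toHomeomorph
  exact ⟨_, Measure.isAddLeftInvariant_eq_smul_of_regular _ _⟩

theorem measurable_dil (k : ℤ) : Measurable (V.dil k) := (V.dil k).continuous.measurable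

theorem ae_eq_comp_dil {f g : G → ℂ} (h : f =ᵐ[V.μ] g) (k : ℤ) :
    (fun x => f (V.dil k x)) =ᵐ[V.μ] fun x => g (V.dil k x) := by
  obtain ⟨c, hc⟩ := V.exists_map_dil_eq_smul k
  exact ae_eq_comp_of_map_eq_smul (V.measurable_dil k) hc h

/-- The operator `f ↦ f ∘ 𝒜ᵏ` on `L²`. -/
noncomputable def dilLp (k : ℤ) : Lp ℂ 2 V.μ →L[ℂ] Lp ℂ 2 V.μ :=
  compLp (V.measurable_dil k) (V.exists_map_dil_eq_smul k).choose_spec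

theorem coeFn_dilLp (k : ℤ) (f : Lp ℂ 2 V.μ) :
    V.dilLp k f =ᵐ[V.μ] fun x => f (V.dil k x) :=
  coeFn_compLp _ _ f

theorem dilLp_neg_dilLp (k : ℤ) (f : Lp ℂ 2 V.μ) : V.dilLp (-k) (V.dilLp k f) = f := by
  refine Lp.ext ((V.coeFn_dilLp _ _).trans ?_)
  filter_upwards [V.ae_eq_comp_dil (V.coeFn_dilLp k f) (-k)] with x hx
  rw [hx, dil_dil_neg]

/-- The operator `f ↦ f (· - y)` on `L²`. -/
noncomputable def transLp (y : G) : Lp ℂ 2 V.μ →L[ℂ] Lp ℂ 2 V.μ :=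
  (Lp.compMeasurePreservingₗᵢ ℂ _ (measurePreserving_sub_right V.μ y)).toContinuousLinearMap

theorem coeFn_transLp (y : G) (f : Lp ℂ 2 V.μ) :
    V.transLp y f =ᵐ[V.μ] fun x => f (x - y) :=
  Lp.coeFn_compMeasurePreserving f (measurePreserving_sub_right V.μ y)

theorem ae_eq_comp_sub {f g : G → ℂ} (h : f =ᵐ[V.μ] g) (y : G) :
    (fun x => f (x - y)) =ᵐ[V.μ] fun x => g (x - y) :=
  (measurePreserving_sub_right V.μ y).quasiMeasurePreserving.ae_eq_comp h

theorem exists_ae_eq_system {φ : G → ℂ} (hφ : MemLp φ 2 V.μ) (j : ℤ) (h : G) :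
    ∃ F : Lp ℂ 2 V.μ, F =ᵐ[V.μ] fun x => φ (V.dil j x - h) := by
  refine ⟨V.dilLp j (V.transLp h hφ.toLp), (V.coeFn_dilLp _ _).trans ?_⟩
  exact V.ae_eq_comp_dil ((V.coeFn_transLp _ _).trans (V.ae_eq_comp_sub hφ.coeFn_toLp h)) j

theorem dilLp_mem_system {φ : G → ℂ} {j : ℤ} {F : Lp ℂ 2 V.μ} (hF : F ∈ V.system φ j) (k : ℤ) :
    V.dilLp k F ∈ V.system φ (j + k) := by
  obtain ⟨h, hh, hF⟩ := hF
  refine ⟨h, hh, (V.coeFn_dilLp k F).trans ?_⟩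
  simp only [dil_add]
  exact V.ae_eq_comp_dil hF k

theorem transLp_mem_system {φ : G → ℂ} {F : Lp ℂ 2 V.μ} (hF : F ∈ V.system φ 0) {k : G}
    (hk : k ∈ V.H₀) : V.transLp k F ∈ V.system φ 0 := by
  obtain ⟨h, hh, hF⟩ := hF
  refine ⟨k + h, V.add_mem_H₀ hk hh, (V.coeFn_transLp k F).trans
    ((V.ae_eq_comp_sub hF k).trans (Eventually.of_forall fun x => ?_))⟩
  simp only [dil_zero, sub_sub]

/-- The measure |f|² dμ is finite and translation invariant, and on a noncompact group such a
measure must vanish. -/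
theorem eq_zero_of_forall_transLp_eq {f : Lp ℂ 2 V.μ} (hf : ∀ y, V.transLp y f = f) : f = 0 := by
  have := V.locallyCompactSpace
  have hdir : Directed (· ⊆ ·) fun n : ℤ => (V.sub n : Set G) := fun m n =>
    ⟨min m n, V.sub_antitone (min_le_left _ _), V.sub_antitone (min_le_right _ _)⟩
  -- If `G` were compact it would equal some `V.sub n`, which misses `V.g (n - 1)`.
  have : NoncompactSpace G := by
    refine ⟨fun hc => ?_⟩
    obtain ⟨n, hn⟩ := hc.elim_directed_cover _ V.isOpen_sub V.iUnion_sub.ge hdir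
    exact V.g_notMem (n - 1) (by simpa using hn (mem_univ (V.g (n - 1))))
  set ν := V.μ.withDensity fun x => ‖f x‖ₑ ^ 2
  have hmeas : AEMeasurable (fun x => ‖f x‖ₑ ^ 2) V.μ :=
    (Lp.aestronglyMeasurable f).enorm.pow_const 2
  have hfin : ν univ ≠ ⊤ := by
    rw [withDensity_apply _ MeasurableSet.univ, Measure.restrict_univ]
    have h1 := (eLpNorm_lt_top_iff_lintegral_rpow_enorm_lt_top (p := 2) two_ne_zero
      ENNReal.ofNat_ne_top).1 (Lp.eLpNorm_lt_top f)
    simpa using h1.ne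
  have : IsFiniteMeasure ν := ⟨hfin.lt_top⟩
  have : ν.IsAddLeftInvariant := by
    refine ⟨fun y => Measure.ext fun s hs => ?_⟩
    rw [Measure.map_apply (measurable_const_add y) hs, withDensity_apply _ hs,
      withDensity_apply _ (hs.preimage (measurable_const_add y)),
      ← lintegral_indicator hs, ← lintegral_indicator (hs.preimage (measurable_const_add y)),
      ← lintegral_add_left_eq_self (μ := V.μ) (s.indicator fun x => ‖f x‖ₑ ^ 2) y]
    refine lintegral_congr_ae ?_
    have h1 := V.coeFn_transLp (-y) f
    rw [hf] at h1
    filter_upwards [h1] with x hx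
    rw [sub_neg_eq_add, add_comm] at hx
    by_cases hxs : y + x ∈ s
    · rw [indicator_of_mem (show x ∈ (y + ·) ⁻¹' s from hxs), indicator_of_mem hxs, hx]
    · rw [indicator_of_notMem (show x ∉ (y + ·) ⁻¹' s from hxs), indicator_of_notMem hxs]
  have hzero : ν univ = 0 := by
    rw [← V.iUnion_sub, measure_iUnion_null_iff]
    intro n
    by_contra h
    -- Positive mass on a compact set makes an invariant measure positive on open sets, hence of
    -- infinite total mass.
    have := isOpenPosMeasure_of_addLeftInvariant_of_compact _ (V.isCompact_sub n) h
    exact hfin (measure_univ_of_isAddLeftInvariant ν)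
  rw [withDensity_apply _ MeasurableSet.univ, Measure.restrict_univ,
    lintegral_eq_zero_iff' hmeas] at hzero
  refine Lp.ext (EventuallyEq.trans ?_ (Lp.coeFn_zero ℂ 2 V.μ).symm)
  filter_upwards [hzero] with x hx
  simpa using hx

/-! ### Density of coset indicators -/

include V in
theorem normalSpace : NormalSpace G := by
  have : SigmaCompactSpace G := by
    rw [← isSigmaCompact_univ_iff, ← V.iUnion_sub]
    exact isSigmaCompact_iUnion_of_isCompact _ V.isCompact_sub
  infer_instance

theorem exists_sub_subset_of_isCompact {K : Set G} (hK : IsCompact K) :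
    ∃ m, K ⊆ V.sub m :=
  hK.elim_directed_cover _ V.isOpen_sub (by rw [V.iUnion_sub]; exact subset_univ _) fun m n =>
    ⟨min m n, V.sub_antitone (min_le_left _ _), V.sub_antitone (min_le_right _ _)⟩

theorem exists_sub_dist_lt {g : G → ℂ} (hs : HasCompactSupport g) (hg : Continuous g) {ε : ℝ}
    (hε : 0 < ε) : ∃ n, ∀ x y, x - y ∈ V.sub n → dist (g x) (g y) < ε := by
  let _ : UniformSpace G := IsTopologicalAddGroup.rightUniformSpace G
  have : IsUniformAddGroup G := isUniformAddGroup_of_addCommGroup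
  have h2 := hs.uniformContinuous_of_continuous hg (Metric.dist_mem_uniformity hε)
  rw [mem_map, uniformity_eq_comap_nhds_zero, mem_comap] at h2
  obtain ⟨U, hU, hU'⟩ := h2
  obtain ⟨n, hn⟩ := V.exists_sub_subset U hU
  refine ⟨n, fun x y hxy => ?_⟩
  have h3 : (y, x) ∈ (fun x : G × G => x.2 - x.1) ⁻¹' U := hn hxy
  rw [dist_comm]
  exact hU' h3

theorem memLp_indicator_ball (y : G) (n : ℤ) :
    MemLp (indicator {x | x - y ∈ V.sub n} fun _ => (1 : ℂ)) 2 V.μ := by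
  have h : MeasurableSet {x : G | x - y ∈ V.sub n} :=
    (V.measurableSet_sub n).preimage (measurable_id.sub_const y)
  refine memLp_indicator_const 2 h 1 (Or.inr ?_)
  have h2 := (measurePreserving_sub_right V.μ y).measure_preimage
    (V.measurableSet_sub n).nullMeasurableSet
  exact (h2.trans_lt (V.μ_sub_lt_top n)).ne

/-- Linear combinations of indicator functions of cosets of the subgroups `G n` are dense in `L²`. -/
theorem closure_eq_univ_of_indicator_mem (W : Submodule ℂ (Lp ℂ 2 V.μ))
    (hW : ∀ y n, (V.memLp_indicator_ball y n).toLp ∈ W) :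
    closure (W : Set (Lp ℂ 2 V.μ)) = univ := by
  classical
  have := V.locallyCompactSpace
  have := V.regular_μ
  have := V.normalSpace
  refine eq_univ_of_forall fun f => Metric.mem_closure_iff.2 fun ε hε => ?_
  obtain ⟨g, hgs, hfg, hgc, hgm⟩ := (Lp.memLp f).exists_hasCompactSupport_eLpNorm_sub_le
    ENNReal.ofNat_ne_top (ε := ENNReal.ofReal (ε / 2)) (by simpa using hε)
  obtain ⟨m, hm⟩ := V.exists_sub_subset_of_isCompact hgs
  have hg0 : ∀ x, x ∉ V.sub m → g x = 0 := fun x hx =>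
    image_eq_zero_of_notMem_tsupport fun h => hx (hm h)
  set M : ℝ := V.μ.real (V.sub m : Set G) ^ (1 / (2 : ENNReal).toReal) with hM
  have hM0 : 0 ≤ M := by positivity
  -- `M` is the L² norm of the indicator of `V.sub m`, so a uniform error of this size costs less
  -- than `ε / 2`.
  have hη : 0 < ε / 2 / (M + 1) := by positivity
  obtain ⟨n', hn'⟩ := V.exists_sub_dist_lt hgs hgc hη
  -- With `n ≥ m`, every coset of `V.sub n` meeting `V.sub m` lies inside it.
  set n := max m n'
  have hn : ∀ x y, x - y ∈ V.sub n → dist (g x) (g y) < ε / 2 / (M + 1) := fun x y h =>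
    hn' x y (V.sub_antitone (le_max_right _ _) h)
  have hnm : V.sub n ≤ V.sub m := V.sub_antitone (le_max_left _ _)
  let π : G → G ⧸ V.sub n := QuotientAddGroup.mk
  have hdisc : DiscreteTopology (G ⧸ V.sub n) := QuotientAddGroup.discreteTopology (V.isOpen_sub n)
  have hfin : (π '' (V.sub m : Set G)).Finite :=
    ((V.isCompact_sub m).image QuotientAddGroup.continuous_mk).finite_of_discrete
  have hπ : ∀ x q, x - q.out ∈ V.sub n ↔ q = π x := by
    intro x q
    rw [← neg_add_eq_sub, ← QuotientAddGroup.eq, QuotientAddGroup.out_eq']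
  -- Sample `g` at one representative of each of the finitely many cosets in `V.sub m`.
  let w : Lp ℂ 2 V.μ := ∑ q ∈ hfin.toFinset, g q.out • (V.memLp_indicator_ball q.out n).toLp
  have hw : w =ᵐ[V.μ] fun x => if x ∈ V.sub m then g (π x).out else 0 := by
    refine (coeFn_sum_smul _ _ _ _ fun q _ => (V.memLp_indicator_ball q.out n).coeFn_toLp).trans
      (Eventually.of_forall fun x => ?_)
    simp only [indicator_apply, mem_ofPred_eq, hπ]
    split_ifs with hx
    · rw [Finset.sum_eq_single (π x)]
      · simp
      · intro q _ hq
        rw [if_neg hq, mul_zero]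
      · intro h
        exact absurd (hfin.mem_toFinset.2 (mem_image_of_mem π hx)) h
    · refine Finset.sum_eq_zero fun q hq => ?_
      rw [if_neg, mul_zero]
      rintro rfl
      obtain ⟨y, hy, hyx⟩ := hfin.mem_toFinset.1 hq
      have h1 : -y + x ∈ V.sub n := QuotientAddGroup.eq.1 hyx
      exact hx (by simpa using add_mem hy (hnm h1))
  refine ⟨w, sum_mem fun q _ => W.smul_mem _ (hW _ _), ?_⟩
  have h1 : ‖f - hgm.toLp‖ ≤ ε / 2 := by
    rw [Lp.norm_def]
    refine ENNReal.toReal_le_of_le_ofReal (by positivity) (le_of_eq_of_le (eLpNorm_congr_ae ?_) hfg)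
    exact (Lp.coeFn_sub _ _).trans (EventuallyEq.rfl.sub hgm.coeFn_toLp)
  have h2 : ‖hgm.toLp - w‖ ≤ ‖indicatorConstLp 2 (V.measurableSet_sub m) (V.μ_sub_lt_top m).ne
      ((ε / 2 / (M + 1) : ℝ) : ℂ)‖ := by
    refine Lp.norm_le_norm_of_ae_le ?_
    filter_upwards [Lp.coeFn_sub hgm.toLp w, hgm.coeFn_toLp, hw,
      indicatorConstLp_coeFn (p := 2) (hs := V.measurableSet_sub m)
        (hμs := (V.μ_sub_lt_top m).ne) (c := ((ε / 2 / (M + 1) : ℝ) : ℂ))] with x h3 h4 h5 h6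
    rw [h3, Pi.sub_apply, h4, h5, h6]
    by_cases hx : x ∈ V.sub m
    · rw [if_pos hx, indicator_of_mem (show x ∈ (V.sub m : Set G) from hx), Complex.norm_real,
        Real.norm_of_nonneg hη.le, ← dist_eq_norm]
      exact (hn _ _ ((hπ _ _).2 rfl)).le
    · rw [if_neg hx, hg0 x hx, sub_zero, norm_zero]
      exact norm_nonneg _
  rw [norm_indicatorConstLp two_ne_zero ENNReal.ofNat_ne_top, Complex.norm_real,
    Real.norm_of_nonneg hη.le, ← hM] at h2
  have h3 : ε / 2 / (M + 1) * M < ε / 2 := by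
    rw [div_mul_eq_mul_div, div_lt_iff₀ (by positivity)]
    nlinarith
  rw [dist_eq_norm]
  calc ‖f - w‖ = ‖(f - hgm.toLp) + (hgm.toLp - w)‖ := by rw [sub_add_sub_cancel]
    _ ≤ ‖f - hgm.toLp‖ + ‖hgm.toLp - w‖ := norm_add_le _ _
    _ < ε := by linarith

end Operators
-- The multiresolution analysis
section MRA

variable {p : ℕ} [Fact p.Prime] {G : Type*} [AddCommGroup G] [TopologicalSpace G]
  [IsTopologicalAddGroup G] (V : VilenkinGroup p G) {f : ZMod p → ZMod p} {L : ℕ}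

theorem eq_val_smul_of_mem_H₀ {k : G} (hk : k ∈ V.H₀) (hk' : k ∈ V.sub (-1)) :
    k = (V.digit k (-1)).val • V.g (-1) := by
  refine V.ext_digit fun n => ?_
  rw [digit_val_nsmul, digit_g]
  split_ifs with h
  · rw [h, mul_one]
  · rw [mul_zero]
    rcases lt_or_ge n (-1) with hn | hn
    · exact V.digit_eq_zero_of_mem hk' hn
    · exact V.mem_H₀_iff.1 hk n (by omega)

theorem orbitChar_zero_mem (hf : ∀ a, f^[L] a = 0) : V.orbitChar f L 0 ∈ V.annihilator (-1) :=
  V.mem_annihilator_iff.2 fun n hn => by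
    obtain ⟨i, rfl⟩ : ∃ i : ℕ, n = (i : ℤ) - 1 := ⟨(n + 1).toNat, by omega⟩
    rw [V.freq_orbitChar hf, Function.iterate_fixed (apply_zero_of_iterate hf)]

/-- Summation over the shifts annihilates every orbit character except the one with `a = 0`, which
is trivial on G_{-1} since 0 is fixed by `f`. -/
theorem sum_treeScaling_sub (hf : ∀ a, f^[L] a = 0) (x : G) :
    ∑ c : ZMod p, V.treeScaling f L (x - c.val • V.g (-1)) =
      indicator (V.sub (-1) : Set G) (fun _ => 1) x := by
  have hp := natCast_ne_zero_of_prime p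
  have hg : ∀ c : ZMod p, c.val • V.g (-1) ∈ V.sub (-1) := fun c => nsmul_mem (V.g_mem _) _
  by_cases hx : x ∈ V.sub (-1)
  · have h1 : ∀ c : ZMod p, V.treeScaling f L (x - c.val • V.g (-1)) =
        (1 / (p : ℂ)) * ∑ a, pairing (V.orbitChar f L a) x * ZMod.stdAddChar (c * -a) := by
      intro c
      rw [treeScaling, indicator_of_mem (show _ ∈ (V.sub (-1) : Set G) from sub_mem hx (hg c))]
      simp only [pairing_sub, pairing_val_smul_g, V.freq_orbitChar_neg_one hf, conj_stdAddChar,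
        mul_neg]
    simp_rw [h1]
    rw [← Finset.mul_sum, Finset.sum_comm, indicator_of_mem (show x ∈ (V.sub (-1) : Set G) from hx)]
    simp_rw [← Finset.mul_sum, sum_stdAddChar_mul, neg_eq_zero]
    rw [Finset.sum_eq_single 0]
    · rw [if_pos rfl, V.orbitChar_zero_mem hf x hx]
      field_simp
    · intro a _ ha
      rw [if_neg ha, mul_zero]
    · simp
  · rw [indicator_of_notMem hx]
    refine Finset.sum_eq_zero fun c _ => ?_
    rw [treeScaling, indicator_of_notMem]
    exact fun h => hx (by simpa using add_mem h (hg c))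

variable [MeasurableSpace G] [BorelSpace G]

/-- A shift outside G_{-1} makes the supports disjoint. Otherwise k = c g_{-1}; expanding the
shifted factor alone leaves conjugated Fourier coefficients, all equal to 1, weighted by a character
sum that vanishes unless c = 0. -/
theorem integral_treeScaling_sub_mul_conj (hf : ∀ a, f^[L] a = 0) {k : G} (hk : k ∈ V.H₀)
    [Decidable (k = 0)] :
    ∫ x, V.treeScaling f L (x - k) * (starRingEnd ℂ) (V.treeScaling f L x) ∂V.μ =
      if k = 0 then 1 else 0 := by
  have hp := natCast_ne_zero_of_prime p
  by_cases hk' : k ∈ V.sub (-1)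
  · set c := V.digit k (-1)
    have hkc : k = c.val • V.g (-1) := V.eq_val_smul_of_mem_H₀ hk hk'
    have h0 : k = 0 ↔ c = 0 := by
      constructor
      · intro h
        simp only [c, h, digit_zero]
      · intro h
        rw [hkc, h, ZMod.val_zero, zero_smul]
    have h1 : ∀ x, V.treeScaling f L (x - k) * (starRingEnd ℂ) (V.treeScaling f L x) =
        ∑ a, (1 / (p : ℂ)) * ZMod.stdAddChar (a * -c) *
          (starRingEnd ℂ) (V.treeScaling f L x * (starRingEnd ℂ)
            (pairing (V.orbitChar f L a) x)) := by
      intro x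
      by_cases hx : x ∈ V.sub (-1)
      · have h3 : V.treeScaling f L (x - k) =
            (1 / (p : ℂ)) * ∑ a, pairing (V.orbitChar f L a) (x - k) :=
          indicator_of_mem (show x - k ∈ (V.sub (-1) : Set G) from sub_mem hx hk') _
        rw [h3, mul_assoc, Finset.sum_mul, Finset.mul_sum]
        refine Finset.sum_congr rfl fun a _ => ?_
        have h4 : pairing (V.orbitChar f L a) k = ZMod.stdAddChar (c * a) := by
          conv_lhs => rw [hkc]
          rw [pairing_val_smul_g, V.freq_orbitChar_neg_one hf]
        rw [pairing_sub, h4, conj_stdAddChar, map_mul (starRingEnd ℂ), Complex.conj_conj, mul_neg,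
          mul_comm a c]
        ring
      · have h2 : V.treeScaling f L x = 0 := indicator_of_notMem hx _
        simp [h2]
    have hint : ∀ a, Integrable (fun x => V.treeScaling f L x * (starRingEnd ℂ)
        (pairing (V.orbitChar f L a) x)) V.μ := fun a =>
      ((V.continuous_treeScaling f L).mul
        (Complex.continuous_conj.comp (continuous_pairing _))).integrable_of_hasCompactSupport
        ((V.hasCompactSupport_treeScaling f L).mul_right)
    simp_rw [h1]
    rw [integral_finsetSum]
    · simp_rw [integral_const_mul, integral_conj]
      have h3 : ∀ a, ∫ x, V.treeScaling f L x * (starRingEnd ℂ)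
          (pairing (V.orbitChar f L a) x) ∂V.μ = 1 := V.fourier_treeScaling_orbitChar hf
      simp_rw [h3, map_one, mul_one]
      rw [← Finset.mul_sum, sum_stdAddChar_mul]
      simp only [h0, neg_eq_zero]
      split_ifs
      · field_simp
      · simp
    · intro a _
      exact ((Complex.conjCLE.toContinuousLinearMap.integrable_comp (hint a)).const_mul _)
  · have h0 : k ≠ 0 := fun h => hk' (h ▸ zero_mem _)
    rw [if_neg h0]
    refine integral_eq_zero_of_ae (Eventually.of_forall fun x => ?_)
    by_cases hx : x ∈ V.sub (-1)
    · have h2 : V.treeScaling f L (x - k) = 0 :=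
        indicator_of_notMem (fun h => hk' (by simpa using sub_mem hx h)) _
      simp [h2]
    · have h2 : V.treeScaling f L x = 0 := indicator_of_notMem hx _
      simp [h2]

theorem isOrthonormalSystem_treeScaling (hf : ∀ a, f^[L] a = 0) :
    V.IsOrthonormalSystem (V.treeScaling f L) := by
  classical
  have hm := V.memLp_treeScaling f L 2
  have he : ∀ h : G, V.transLp h hm.toLp =ᵐ[V.μ] fun x => V.treeScaling f L (x - h) := fun h =>
    (V.coeFn_transLp h _).trans (V.ae_eq_comp_sub hm.coeFn_toLp h)
  refine ⟨fun h => V.transLp h hm.toLp, fun h => he h, orthonormal_iff_ite.2 fun h k => ?_⟩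
  rw [L2.inner_def]
  have h1 : ∫ x, inner ℂ (V.transLp h hm.toLp x) (V.transLp k hm.toLp x) ∂V.μ =
      ∫ x, V.treeScaling f L (x - h - (k - h)) *
        (starRingEnd ℂ) (V.treeScaling f L (x - h)) ∂V.μ := by
    refine integral_congr_ae ?_
    filter_upwards [he h, he k] with x hx hx'
    rw [hx, hx', RCLike.inner_apply, sub_sub_sub_cancel_right]
  rw [h1, integral_sub_right_eq_self (μ := V.μ) (fun x => V.treeScaling f L (x - (k - h)) *
    (starRingEnd ℂ) (V.treeScaling f L x)) (h : G),
    V.integral_treeScaling_sub_mul_conj hf (V.sub_mem_H₀ k.2 h.2)]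
  refine if_congr ?_ rfl rfl
  rw [sub_eq_zero, Subtype.ext_iff, eq_comm]

theorem system_subset_span (hf : ∀ a, f^[L] a = 0) (j : ℤ) :
    V.system (V.treeScaling f L) j ⊆ Submodule.span ℂ (V.system (V.treeScaling f L) (j + 1)) := by
  rintro F ⟨h, hh, hF⟩
  have hm := V.memLp_treeScaling f L 2
  choose E hE using V.exists_ae_eq_system hm (j + 1)
  refine mem_of_ae_eq_sum (s := Finset.univ) (c := treeCoeff f)
    (U := fun a => E (V.dil 1 h + V.shiftPoint a)) (fun a _ => hE _) (fun a _ => ?_)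
    (hF.trans (Eventually.of_forall fun x => ?_))
  · exact Submodule.subset_span
      ⟨_, V.add_mem_H₀ (V.dil_one_mem_H₀ hh) ⟨2, a, rfl⟩, hE _⟩
  · refine (V.satisfiesRefinement_treeScaling hf _).trans (Finset.sum_congr rfl fun a _ => ?_)
    rw [map_sub, ← dil_add, add_comm 1 j, sub_sub]

theorem toLp_indicator_mem_span (hf : ∀ a, f^[L] a = 0) (y : G) (n : ℤ) :
    (V.memLp_indicator_ball y n).toLp ∈
      Submodule.span ℂ (V.system (V.treeScaling f L) (n + 1)) := by
  have hm := V.memLp_treeScaling f L 2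
  choose E hE using V.exists_ae_eq_system hm (n + 1)
  -- The dilation by `n + 1` carries y + G_n to h + G_{-1}, since 𝒜^{n+1} y - h lies in G_0 ⊆
  -- G_{-1}.
  obtain ⟨h, hh, hy⟩ := V.exists_mem_H₀_sub_mem (V.dil (n + 1) y)
  refine mem_of_ae_eq_sum (s := Finset.univ) (c := fun _ => 1)
    (U := fun c : ZMod p => E (h + c.val • V.g (-1))) (fun c _ => hE _) (fun c _ => ?_)
    ((V.memLp_indicator_ball y n).coeFn_toLp.trans (Eventually.of_forall fun x => ?_))
  · exact Submodule.subset_span ⟨_, V.add_mem_H₀ hh (V.val_smul_g_mem_H₀ c), hE _⟩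
  · simp only [one_mul, ← sub_sub]
    rw [V.sum_treeScaling_sub hf]
    have h1 : x - y ∈ V.sub n ↔ V.dil (n + 1) x - h ∈ V.sub (-1) := by
      have h2 : x - y ∈ V.sub n ↔ V.dil (n + 1) (x - y) ∈ V.sub (-1) := by
        rw [dil_mem_sub_iff, neg_add_cancel_comm_assoc]
      have h3 : V.dil (n + 1) x - h = V.dil (n + 1) (x - y) + (V.dil (n + 1) y - h) := by
        rw [map_sub, sub_add_sub_cancel]
      rw [h2, h3, AddSubgroup.add_mem_cancel_right]
      exact V.sub_antitone (by norm_num) hy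
    by_cases hx : x - y ∈ V.sub n
    · rw [indicator_of_mem (show x ∈ {x | x - y ∈ V.sub n} from hx), indicator_of_mem (h1.1 hx)]
    · rw [indicator_of_notMem (show x ∉ {x | x - y ∈ V.sub n} from hx),
        indicator_of_notMem fun h => hx (h1.2 h)]

/-- The generators at level `j` are constant on the cosets of G_{L-1+j}, and invariance under a
translation is a closed linear condition. -/
theorem transLp_eq_of_mem_closure (hf : ∀ a, f^[L] a = 0) {j : ℤ} {y : G}
    (hy : y ∈ V.sub (L - 1 + j)) {F : Lp ℂ 2 V.μ}
    (hF : F ∈ (Submodule.span ℂ (V.system (V.treeScaling f L) j)).topologicalClosure) :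
    V.transLp y F = F := by
  have h1 : Submodule.span ℂ (V.system (V.treeScaling f L) j) ≤
      LinearMap.eqLocus (V.transLp y : Lp ℂ 2 V.μ →ₗ[ℂ] Lp ℂ 2 V.μ) LinearMap.id := by
    refine Submodule.span_le.2 ?_
    rintro F ⟨h, -, hF⟩
    refine Lp.ext ((V.coeFn_transLp y F).trans ((V.ae_eq_comp_sub hF y).trans
      (EventuallyEq.trans (Eventually.of_forall fun x => ?_) hF.symm)))
    have h2 : V.dil j (x - y) - h = V.dil j x - h + -V.dil j y := by
      rw [map_sub]
      abel
    simp only [h2]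
    exact V.treeScaling_add_mem hf _ (neg_mem (V.dil_mem_sub_iff.2 hy))
  have h2 : IsClosed {F : Lp ℂ 2 V.μ | V.transLp y F = F} :=
    isClosed_eq (V.transLp y).continuous continuous_id
  exact closure_minimal (fun F hF => h1 hF) h2 hF

theorem generatesMRA_treeScaling (hf : ∀ a, f^[L] a = 0) :
    V.GeneratesMRA (V.treeScaling f L) := by
  have hort := V.isOrthonormalSystem_treeScaling hf
  have hmono : ∀ n, (Submodule.span ℂ (V.system (V.treeScaling f L) n)).topologicalClosure ≤
      (Submodule.span ℂ (V.system (V.treeScaling f L) (n + 1))).topologicalClosure := fun n =>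
    Submodule.topologicalClosure_mono (Submodule.span_le.2 (V.system_subset_span hf n))
  refine ⟨hort, fun n => Submodule.isClosed_topologicalClosure _, hmono, ?_, ?_, ?_, ?_, ?_⟩
  · have hdir := (monotone_int_of_le_succ hmono).directed_le
    rw [← Submodule.coe_iSup_of_directed _ hdir]
    refine V.closure_eq_univ_of_indicator_mem _ fun y n => ?_
    exact Submodule.mem_iSup_of_mem (n + 1)
      (Submodule.le_topologicalClosure _ (V.toLp_indicator_mem_span hf y n))
  · refine eq_singleton_iff_unique_mem.2 ⟨mem_iInter.2 fun n => zero_mem _, fun F hF => ?_⟩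
    refine V.eq_zero_of_forall_transLp_eq fun y => ?_
    obtain ⟨m, hm⟩ := mem_iUnion.1 (V.iUnion_sub ▸ mem_univ y : y ∈ ⋃ n, (V.sub n : Set G))
    -- This level is so coarse that its functions are invariant under all of `V.sub m`, which
    -- contains `y`.
    refine V.transLp_eq_of_mem_closure hf (j := m - (L - 1)) ?_ (mem_iInter.1 hF _)
    rwa [add_sub_cancel]
  · intro n F F' hF
    obtain rfl : F' = V.dilLp 1 F := Lp.ext (hF.trans (V.coeFn_dilLp 1 F).symm)
    constructor
    · exact map_mem_closure_span (V.dilLp 1) fun E hE => V.dilLp_mem_system hE 1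
    · intro h
      have := map_mem_closure_span (V.dilLp (-1)) (fun E hE => V.dilLp_mem_system hE (-1)) h
      rwa [dilLp_neg_dilLp, add_neg_cancel_right] at this
  · intro F hF h hh F' hF'
    obtain rfl : F' = V.transLp h F := Lp.ext (hF'.trans (V.coeFn_transLp h F).symm)
    exact map_mem_closure_span (V.transLp h) (fun E hE => V.transLp_mem_system hE hh) hF
  · exact ⟨_, hort, rfl⟩

end MRA

/-! ### The chain tree and the conclusion -/

/-- The map on `ZMod p` given by the chain of arrows `m → m - 1 → ⋯ → 1 → 0`; every element
outside the chain is sent to `0`. -/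
def chainMap (p m : ℕ) (a : ZMod p) : ZMod p :=
  if a.val ≤ m then ((a.val - 1 : ℕ) : ZMod p) else 0

theorem chainMap_iterate_natCast {p m n : ℕ} (hm : m < p) (hn : n ≤ m) (i : ℕ) :
    (chainMap p m)^[i] (n : ZMod p) = ((n - i : ℕ) : ZMod p) := by
  induction i with
  | zero => rfl
  | succ i ih =>
    rw [Function.iterate_succ_apply', ih, chainMap, ZMod.val_cast_of_lt (by omega),
      if_pos (by omega), Nat.sub_sub]

/-- Chain elements descend by one per step, with truncated subtraction keeping 0 fixed. The others
need one step, whence `0 < m`. -/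
theorem chainMap_iterate_eq_zero {p m : ℕ} (hm : m < p) (hm0 : 0 < m) (a : ZMod p) :
    (chainMap p m)^[m] a = 0 := by
  have : NeZero p := ⟨by omega⟩
  by_cases ha : a.val ≤ m
  · rw [← ZMod.natCast_zmod_val a, chainMap_iterate_natCast hm ha, Nat.sub_eq_zero_of_le ha,
      Nat.cast_zero]
  · obtain ⟨k, rfl⟩ := Nat.exists_eq_succ_of_ne_zero hm0.ne'
    rw [Function.iterate_succ_apply, chainMap, if_neg ha]
    simpa using chainMap_iterate_natCast hm (Nat.zero_le _) k

end VilenkinGroup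

theorem theorem4p6 {p : ℕ} [Fact p.Prime] (hp : 3 ≤ p)
    {G : Type*} [AddCommGroup G] [TopologicalSpace G] [IsTopologicalAddGroup G]
    [MeasurableSpace G] [BorelSpace G] (V : VilenkinGroup p G)
    (l : ℕ) (hl₁ : 1 ≤ l) (hl₂ : l ≤ p - 2) :
    ∃ φ : G → ℂ,
      V.IsStep l 1 φ ∧
      V.IsElementaryRefinable 1 φ ∧
      V.GeneratesMRA φ ∧
      ∃ χ ∈ V.annihilator l \ V.annihilator (l - 1), V.fourier φ χ ≠ 0 := by
  have hlp : l + 1 < p := by omega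
  have hf := VilenkinGroup.chainMap_iterate_eq_zero hlp l.succ_pos
  have hl : ((l + 1 : ℕ) : ℤ) - 1 = l := by push_cast; ring
  -- Height `l + 1` gives constancy on the cosets of G_l, because frequencies start at index -1.
  refine ⟨V.treeScaling (VilenkinGroup.chainMap p (l + 1)) (l + 1), ?_,
    V.isElementaryRefinable_treeScaling hf, V.generatesMRA_treeScaling hf,
    V.orbitChar (VilenkinGroup.chainMap p (l + 1)) (l + 1) ((l + 1 : ℕ) : ZMod p),
    ⟨?_, fun h => ?_⟩, ?_⟩
  · have := V.isStep_treeScaling hf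
    rwa [hl] at this
  · have := V.orbitChar_mem_annihilator hf ((l + 1 : ℕ) : ZMod p)
    rwa [hl] at this
  -- The frequency at `l - 1` is the `l`-th iterate of `l + 1`, namely 1.
  · have h1 := V.mem_annihilator_iff.1 h _ le_rfl
    rw [V.freq_orbitChar hf, VilenkinGroup.chainMap_iterate_natCast hlp le_rfl] at h1
    simp at h1
  · rw [V.fourier_treeScaling_orbitChar hf]
    exact one_ne_zero
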